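/- Fix $k\in\{1,2,3,4\}$. For $n>k$ let $\Delta(k)$ be the $k$-th order difference operator on $\mathbb R^n$, $(\Delta(k)f)_i=\sum_{l=0}^k(-1)^l\binom kl f_{i-l}$ for $i\in\mathcal D=\{k+1,\dots,n\}$, and write $\|v\|_n^2=\frac1n\sum_{i=1}^n v_i^2$. For each $n>k$ let $S=\{t_1<\dots<t_s\}\subseteq\mathcal D$ (where $S$ and $s$ may depend on $n$), and put $t_0=k$, $t_{s+1}=n+1$, $n_i=t_i-t_{i-1}$ for $1\le i\le s+1$, and $n_{\max}=\max_{1\le i\le s+1}n_i$. Assume that, as $n\to\infty$, $$\min_{1\le i\le s+1}n_i\asymp n_{\max},$$ and that $\min_{1\le i\le s+1}n_i\ge k(k+2)$ for all sufficiently large $n$. Then there are tuning parameters $\lambda=\lambda_n>0$, depending only on $n$, $k$ and the sequence of sets $S$, with $$\lambda\asymp n^{k-1}\Big(\frac1{s+1}\Big)^{\frac{2k-1}2}\sqrt{\frac{\log n}n},$$ such that the following holds for all (sequences of) $f^0\in\mathbb R^n$. Let $Y\sim\mathcal N_n(f^0,I)$ and let $$\hat f=\arg\min_{f\in\mathbb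 R^n}\big\{\|Y-f\|_n^2+2\lambda\|\Delta(k)f\|_1\big\}.$$ Then for all (sequences of) $f\in\mathbb R^n$, $$\|\hat f-f^0\|_n^2\le\|f-f^0\|_n^2+4\lambda\,\|(\Delta(k)f)_{-S}\|_1+\mathcal O_{\mathbb P}\Big(\frac{s+1}n\log\Big(\frac n{s+1}\Big)\log n\Big),$$ where $\|(\Delta(k)f)_{-S}\|_1=\sum_{j\in\mathcal D\setminus S}|(\Delta(k)f)_j|$. Here $a_n\asymp b_n$ means that $a_n/b_n$ and $b_n/a_n$ are bounded for all large $n$, and $Z_n=\mathcal O_{\mathbb P}(r_n)$ means $\lim_{M\to\infty}\limsup_{n\to\infty}\mathbb P(|Z_n|/r_n>M)=0$. -/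

import Mathlib

open Filter Topology Asymptotics MeasureTheory ProbabilityTheory

namespace TrendFiltering

noncomputable section

/-- Vectors in `ℝ^n`, with coordinates indexed by `[1 : n]`. -/
abbrev Vec (n : ℕ) : Type := Finset.Icc 1 n → ℝ

/-- The row index set `[k+1 : n]` of the `k`-th order difference operator. -/
abbrev Rows (k n : ℕ) : Type := Finset.Icc (k + 1) n

/-- The `k`-th order difference operator `Δ(k)`, an `(n-k) × n` matrix: its entry `(i, j)` is
`(-1)^l * (k choose l)` if `j = i - l` with `l ∈ [0 : k]`, and `0` otherwise. -/
def diffOp (k n : ℕ) : Matrix (Rows k n) (Finset.Icc 1 n) ℝ :=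
  Matrix.of fun i j =>
    if (j : ℕ) ≤ i ∧ (i : ℕ) ≤ j + k then
      (-1 : ℝ) ^ ((i : ℕ) - j) * (k.choose ((i : ℕ) - j) : ℝ)
    else 0

/-- The normalised squared norm `‖v‖_n² = (∑ v_i²) / n`. -/
def sqNorm {n : ℕ} (v : Vec n) : ℝ := (∑ i, v i ^ 2) / n

/-- The penalised least squares criterion `‖y - f‖_n² + 2 λ ‖Δ(k) f‖₁`. -/
def criterion (k : ℕ) {n : ℕ} (lam : ℝ) (y f : Vec n) : ℝ :=
  sqNorm (y - f) + 2 * lam * ∑ i, |(diffOp k n).mulVec f i|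

/-- `g` is the trend filtering estimate for the data `y`: a minimiser over `ℝ^n` of the
penalised least squares criterion. -/
def IsEstimate (k : ℕ) {n : ℕ} (lam : ℝ) (y g : Vec n) : Prop :=
  ∀ f : Vec n, criterion k lam y g ≤ criterion k lam y f

/-- `t` lists the points `k = t_0 < t_1 < ⋯ < t_s < t_{s+1} = n + 1`; thus
`{t_1, …, t_s}` is a subset of `[k+1 : n]` with `s` elements. -/
def IsKnots (k n s : ℕ) (t : ℕ → ℕ) : Prop :=
  t 0 = k ∧ t (s + 1) = n + 1 ∧ ∀ i ≤ s, t i < t (i + 1)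

/-- The active set `S = {t_1, …, t_s}`. -/
def activeSet (s : ℕ) (t : ℕ → ℕ) : Finset ℕ := (Finset.Icc 1 s).image t

/-- The segment lengths `n_i = t_i - t_{i-1}`, for `i ∈ [1 : s+1]`. -/
def segLen (t : ℕ → ℕ) (i : ℕ) : ℕ := t i - t (i - 1)

/-- The largest segment length. -/
def maxLen (s : ℕ) (t : ℕ → ℕ) : ℕ :=
  (Finset.Icc 1 (s + 1)).sup' ⟨1, by simp⟩ (segLen t)

/-- The smallest segment length. -/
def minLen (s : ℕ) (t : ℕ → ℕ) : ℕ :=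
  (Finset.Icc 1 (s + 1)).inf' ⟨1, by simp⟩ (segLen t)

/-- `‖(Δ(k) f)_{-S}‖₁`, the `ℓ₁`-norm of the differences of `f` outside `S`. -/
def offNorm (k : ℕ) {n : ℕ} (S : Finset ℕ) (f : Vec n) : ℝ :=
  ∑ i : Rows k n, if (i : ℕ) ∈ S then 0 else |(diffOp k n).mulVec f i|

/-- The order of the tuning parameter,
`n^{k-1} (1 / (s+1))^{(2k-1)/2} √(log n / n)`. -/
def tuningRate (k n s : ℕ) : ℝ :=
  (n : ℝ) ^ (k - 1) * (1 / ((s : ℝ) + 1)) ^ ((2 * (k : ℝ) - 1) / 2) * √(Real.log n / n)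

/-- The order of the remainder, `((s+1) / n) log (n / (s+1)) log n`. -/
def remainderRate (n s : ℕ) : ℝ :=
  ((s : ℝ) + 1) / n * Real.log (n / ((s : ℝ) + 1)) * Real.log n

/-- The law `N_n(μ, I)` on `ℝ^n`: independent Gaussian coordinates with means `μ_i` and
variance one. -/
def gaussianLaw {n : ℕ} (μ : Vec n) : Measure (Vec n) :=
  Measure.pi fun i => gaussianReal (μ i) 1

/-- `Z_n = O_P(1)`: `lim_{M → ∞} limsup_{n → ∞} P(|Z_n| > M) = 0`. The variables `Z_n` may live
on different probability spaces. -/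
def IsBoundedInProb {Ω : ℕ → Type*} [∀ n, MeasurableSpace (Ω n)] (P : ∀ n, Measure (Ω n))
    (Z : ∀ n, Ω n → ℝ) : Prop :=
  Tendsto (fun M : ℝ => limsup (fun n => P n {ω | M < |Z n ω|}) atTop) atTop (𝓝 0)

end

end TrendFiltering

namespace TrendFiltering


/-! Write `h` for the estimate minus the comparison vector `f`, and `ε` for the noise. Optimality
gives a basic inequality that bounds the excess risk by a noise term `⟨ε, h⟩` plus `λ` times a drop
in penalty, with a spare `-‖h‖²` to absorb terms linear in `‖h‖`.

Noise (`exists_noise_forms`). Discard the `k` rows starting at each knot. The kernel of the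
remaining rows has dimension at most `k(s+1)`, so the noise on it costs `√(k(s+1) log n) ‖h‖`.
Modulo this kernel, `h` is a combination of truncated Green functions `ψ_j` with coefficients
`(Δh)_j`. Since `‖ψ_j‖²` is at most the distance from `j` to the nearest knot to the power `2k-1`,
the noise costs `√(log n) ‖ψ_j‖ |(Δh)_j|` at row `j`. The order of `λ` is the one at which the
penalty dominates this weight even in the longest segment.

Penalty (`IsKnots.exists_oracle_forms`). If `Q` equals the sign of `Δf` on `S` and `1 - |Q_j|`
exceeds the relative noise weight at the retained rows, then noise and penalty drop together leave
`2‖(Δf)_{-S}‖₁ - ⟨Q, Δh⟩`, and the last term is at most `‖Δᵀ Q‖ ‖h‖`. Such a `Q` must have cusps of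
order `k - 1/2` at the knots. `exists_interpolating_bump` builds one with energy of order `log b /
b^(2k-1)` per knot, where `b` is comparable to the segment length; this produces the factor `log
(n/(s+1))`. Completing the square in `‖h‖` finishes the argument in `IsKnots.oracle_event`. -/

/-! ### Difference operators and Green kernels on `ℤ`. -/

lemma diffOp_mulVec_eq_fwdDiff {k n : ℕ} (f : Vec n) (F : ℤ → ℝ)
    (hF : ∀ j : Finset.Icc 1 n, F (j : ℕ) = f j) (i : Rows k n) :
    (diffOp k n).mulVec f i = (fwdDiff (1 : ℤ))^[k] F ((i : ℕ) - k : ℤ) := by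
  obtain ⟨i, hi⟩ := i
  rw [Finset.mem_Icc] at hi
  obtain ⟨a, rfl⟩ : ∃ a, i = a + k := ⟨i - k, by omega⟩
  rw [fwdDiff_iter_eq_sum_shift]
  simp only [Matrix.mulVec, dotProduct, diffOp, Matrix.of_apply]
  simp_rw [← hF]
  rw [Finset.sum_coe_sort (Finset.Icc 1 n)
    (fun j => (if j ≤ a + k ∧ a + k ≤ j + k then (-1 : ℝ) ^ (a + k - j) * (k.choose (a + k - j) : ℝ)
      else 0) * F j)]
  simp_rw [ite_mul, zero_mul]
  rw [← Finset.sum_filter]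
  have hset : (Finset.Icc 1 n).filter (fun j => j ≤ a + k ∧ a + k ≤ j + k) =
      Finset.Icc a (a + k) := by
    ext j; simp only [Finset.mem_filter, Finset.mem_Icc]; omega
  rw [hset, ← Finset.Ico_add_one_right_eq_Icc, Finset.sum_Ico_eq_sum_range]
  have : a + k + 1 - a = k + 1 := by omega
  rw [this]
  refine Finset.sum_congr rfl fun r hr => ?_
  rw [Finset.mem_range] at hr
  have h1 : a + k - (a + r) = k - r := by omega
  rw [h1, Nat.choose_symm (by omega)]
  simp only [zsmul_eq_mul, nsmul_eq_mul, mul_one]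
  push_cast
  congr 2
  ring_nf

/-- Summation by parts: extending `q` by zero outside the rows removes all boundary terms, so `Δᵀ q`
can be studied through a function on `ℤ`. -/
lemma diffOp_vecMul_eq_fwdDiff {k n : ℕ} (q : Rows k n → ℝ) (Q : ℤ → ℝ)
    (hQ : ∀ j : Rows k n, Q (j : ℕ) = q j)
    (hQ0 : ∀ j : ℕ, j ∉ Finset.Icc (k + 1) n → Q j = 0) (x : Finset.Icc 1 n) :
    Matrix.vecMul q (diffOp k n) x = (-1) ^ k * (fwdDiff (1 : ℤ))^[k] Q (x : ℕ) := by
  obtain ⟨a, ha⟩ := x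
  rw [Finset.mem_Icc] at ha
  rw [fwdDiff_iter_eq_sum_shift]
  simp only [Matrix.vecMul, dotProduct, diffOp, Matrix.of_apply]
  simp_rw [← hQ]
  rw [Finset.sum_coe_sort (Finset.Icc (k + 1) n)
    (fun j => Q j * (if a ≤ j ∧ j ≤ a + k then (-1 : ℝ) ^ (j - a) * (k.choose (j - a) : ℝ)
      else 0))]
  simp_rw [mul_ite, mul_zero]
  rw [← Finset.sum_filter]
  have hset : (Finset.Icc (k + 1) n).filter (fun j => a ≤ j ∧ j ≤ a + k) ⊆
      Finset.Icc a (a + k) := by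
    intro j; simp only [Finset.mem_filter, Finset.mem_Icc]; omega
  rw [Finset.sum_subset hset, ← Finset.Ico_add_one_right_eq_Icc, Finset.sum_Ico_eq_sum_range]
  · have : a + k + 1 - a = k + 1 := by omega
    rw [this, Finset.mul_sum]
    refine Finset.sum_congr rfl fun r hr => ?_
    rw [Finset.mem_range] at hr
    have h1 : a + r - a = r := by omega
    have h2 : (-1 : ℝ) ^ k * (-1) ^ (k - r) = (-1) ^ r := by
      obtain ⟨c, rfl⟩ : ∃ c, k = r + c := ⟨k - r, by omega⟩
      rw [Nat.add_sub_cancel_left, pow_add, mul_assoc, ← mul_pow]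
      simp
    rw [h1, ← h2]
    simp only [zsmul_eq_mul, nsmul_eq_mul, mul_one]
    push_cast
    ring
  · intro j hj hj'
    rw [hQ0 j, zero_mul]
    simp only [Finset.mem_filter, Finset.mem_Icc] at hj hj' ⊢
    omega

lemma fwdDiff_iter_congr {k : ℕ} {F G : ℤ → ℝ} {y : ℤ}
    (h : ∀ r ∈ Finset.range (k + 1), F (y + r) = G (y + r)) :
    (fwdDiff (1 : ℤ))^[k] F y = (fwdDiff (1 : ℤ))^[k] G y := by
  rw [fwdDiff_iter_eq_sum_shift, fwdDiff_iter_eq_sum_shift]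
  refine Finset.sum_congr rfl fun r hr => ?_
  have := h r hr
  simp only [mul_one, nsmul_eq_mul]
  rw [this]

lemma fwdDiff_iter_eq_zero {k : ℕ} {F : ℤ → ℝ} {y : ℤ}
    (h : ∀ r ∈ Finset.range (k + 1), F (y + r) = 0) :
    (fwdDiff (1 : ℤ))^[k] F y = 0 := by
  rw [fwdDiff_iter_eq_sum_shift]
  refine Finset.sum_eq_zero fun r hr => ?_
  have := h r hr
  simp only [mul_one, nsmul_eq_mul]
  rw [this, smul_zero]

/-- Reflection of iterated forward differences. -/
lemma fwdDiff_iter_reflect (k : ℕ) (F : ℤ → ℝ) (c y : ℤ) :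
    (fwdDiff (1 : ℤ))^[k] (fun x => F (c - x)) y =
      (-1) ^ k * (fwdDiff (1 : ℤ))^[k] F (c - y - k) := by
  rw [fwdDiff_iter_eq_sum_shift, fwdDiff_iter_eq_sum_shift, ← Finset.sum_range_reflect,
    Finset.mul_sum]
  refine Finset.sum_congr rfl fun r hr => ?_
  rw [Finset.mem_range] at hr
  obtain ⟨d, rfl⟩ : ∃ d, k = r + d := ⟨k - r, by omega⟩
  have h1 : r + d + 1 - 1 - r = d := by omega
  have h2 : r + d - d = r := by omega
  have h3 : r + d - r = d := by omega
  have h4 : (r + d).choose d = (r + d).choose r := by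
    rw [← Nat.choose_symm_add]
  rw [h1, h2, h3, h4]
  simp only [mul_one, zsmul_eq_mul, nsmul_eq_mul]
  push_cast
  have h5 : (-1 : ℝ) ^ (r + d) * (-1) ^ d = (-1) ^ r := by
    rw [pow_add, mul_assoc, ← mul_pow]; simp
  rw [← h5]
  have h6 : c - (y + (d : ℤ)) = c - y - (r + d) + r := by ring
  rw [h6]
  ring

/-- The causal fundamental solution of the `k`-th difference operator on `ℤ`. -/
noncomputable def greenKernel : ℕ → ℤ → ℝ
  | 0 => fun y => if y = 0 then 1 else 0
  | k + 1 => fun y => ∑ i ∈ Finset.Icc 0 y, greenKernel k i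

lemma greenKernel_of_neg (k : ℕ) {y : ℤ} (hy : y < 0) : greenKernel k y = 0 := by
  cases k with
  | zero => simp [greenKernel, hy.ne]
  | succ k => simp [greenKernel, Finset.Icc_eq_empty_of_lt hy]

lemma fwdDiff_greenKernel (k : ℕ) :
    fwdDiff (1 : ℤ) (greenKernel (k + 1)) = fun y => greenKernel k (y + 1) := by
  ext y
  simp only [fwdDiff]
  rcases lt_or_ge y (-1) with hy | hy
  · rw [greenKernel_of_neg _ (by omega : y + 1 < 0), greenKernel_of_neg _ (by omega : y < 0),
      greenKernel_of_neg _ (by omega : y + 1 < 0), sub_zero]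
  · have : Finset.Icc 0 (y + 1) = insert (y + 1) (Finset.Icc 0 y) := by
      ext j; simp only [Finset.mem_insert, Finset.mem_Icc]; omega
    change ∑ i ∈ Finset.Icc 0 (y + 1), greenKernel k i - ∑ i ∈ Finset.Icc 0 y, greenKernel k i = _
    rw [this, Finset.sum_insert (by simp), add_sub_cancel_right]

/-- Each difference moves the unit mass one step left. Row `i` of `diffOp` reads the `k`-th
difference at `i - k`, which undoes the shift. -/
lemma fwdDiff_iter_greenKernel (k : ℕ) (y : ℤ) :
    (fwdDiff (1 : ℤ))^[k] (greenKernel k) y = if y + k = 0 then 1 else 0 := by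
  induction k generalizing y with
  | zero => simp [greenKernel]
  | succ k ih =>
    rw [Function.iterate_succ_apply, fwdDiff_greenKernel, fwdDiff_iter_comp_add, ih]
    push_cast
    congr 1
    rw [eq_iff_iff]
    constructor <;> intro h <;> linarith

lemma greenKernel_nonneg (k : ℕ) (y : ℤ) : 0 ≤ greenKernel k y := by
  induction k generalizing y with
  | zero => simp only [greenKernel]; positivity
  | succ k ih => exact Finset.sum_nonneg fun i _ => ih i

lemma greenKernel_succ_le (k : ℕ) {y : ℤ} (hy : -1 ≤ y) :
    greenKernel (k + 1) y ≤ ((y : ℝ) + 1) ^ k := by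
  induction k generalizing y with
  | zero =>
    simp only [greenKernel, pow_zero]
    rw [Finset.sum_ite_eq']
    split_ifs <;> norm_num
  | succ k ih =>
    have hy' : (0 : ℝ) ≤ y + 1 := by exact_mod_cast (by omega : 0 ≤ y + 1)
    calc greenKernel (k + 2) y = ∑ i ∈ Finset.Icc 0 y, greenKernel (k + 1) i := rfl
      _ ≤ ∑ i ∈ Finset.Icc 0 y, ((y : ℝ) + 1) ^ k := by
        refine Finset.sum_le_sum fun i hi => ?_
        rw [Finset.mem_Icc] at hi
        refine (ih (by omega)).trans ?_
        have h1 : (i : ℝ) ≤ y := by exact_mod_cast hi.2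
        have h2 : (0 : ℝ) ≤ i := by exact_mod_cast hi.1
        gcongr
      _ = ((y : ℝ) + 1) ^ (k + 1) := by
        rw [Finset.sum_const, Int.card_Icc, nsmul_eq_mul, pow_succ']
        congr 1
        have : (((y + 1 - 0).toNat : ℤ) : ℝ) = ((y + 1 : ℤ) : ℝ) := by
          congr 1; omega
        push_cast at this
        exact_mod_cast this


/-! ### Gaussian tail bounds. -/

lemma hasSubgaussianMGF_gaussianReal_sub (m : ℝ) :
    HasSubgaussianMGF (fun x : ℝ => x - m) 1 (gaussianReal m 1) where
  integrable_exp_mul t := by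
    have := (integrable_exp_mul_gaussianReal (μ := m) (v := 1) t).mul_const (Real.exp (-(t * m)))
    refine this.congr (Eventually.of_forall fun x => ?_)
    simp only
    rw [← Real.exp_add]
    congr 1
    ring
  mgf_le t := by
    rw [mgf_gaussianReal (μ := 0) (v := 1)]
    · simp
    · simpa using gaussianReal_map_sub_const (μ := m) (v := 1) m

lemma gaussianLaw_sum_ge_le {n : ℕ} (μ a : Vec n) {x v : ℝ} (hx : 0 ≤ x)
    (hv : ∑ i, a i ^ 2 = v) :
    (gaussianLaw μ).real {y | x ≤ ∑ i, a i * (y i - μ i)} ≤ Real.exp (-x ^ 2 / (2 * v)) := by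
  have hsub : ∀ i ∈ (Finset.univ : Finset (Finset.Icc 1 n)), HasSubgaussianMGF
      (fun y : Vec n => a i * (y i - μ i)) (⟨a i ^ 2, sq_nonneg _⟩ * 1) (gaussianLaw μ) := by
    intro i _
    refine HasSubgaussianMGF.const_mul (X := fun y : Vec n => y i - μ i) (c := 1) ?_ (a i)
    have hmp := measurePreserving_eval (fun i => gaussianReal (μ i) 1) i
    refine HasSubgaussianMGF.of_map (Y := fun y : Vec n => y i)
      (X := fun z : ℝ => z - μ i) hmp.aemeasurable ?_
    have : Measure.map (fun y : Vec n => y i) (gaussianLaw μ) = gaussianReal (μ i) 1 := hmp.map_eq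
    rw [this]
    exact hasSubgaussianMGF_gaussianReal_sub _
  have hind : iIndepFun (fun i (y : Vec n) => a i * (y i - μ i)) (gaussianLaw μ) :=
    iIndepFun_pi (X := fun i z => a i * (z - μ i)) fun i => by fun_prop
  have := HasSubgaussianMGF.measure_sum_ge_le_of_iIndepFun hind hsub hx
  convert this using 3
  rw [← hv, NNReal.coe_sum]
  congr 1
  refine Finset.sum_congr rfl fun i _ => ?_
  exact (mul_one (a i ^ 2)).symm

lemma gaussianLaw_abs_sum_gt_le {n : ℕ} (hn : 1 ≤ n) (μ a : Vec n) {β : ℝ} (hβ : 0 ≤ β)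
    (ha : ∑ i, a i ^ 2 ≤ β ^ 2) :
    gaussianLaw μ {y | 2 * √(Real.log n) * β < |∑ i, a i * (y i - μ i)|} ≤
      ENNReal.ofReal (2 / (n : ℝ) ^ 2) := by
  have hn0 : (0 : ℝ) < n := by exact_mod_cast hn
  have : IsProbabilityMeasure (gaussianLaw μ) := by unfold gaussianLaw; infer_instance
  rcases hβ.eq_or_lt with rfl | hβ
  · have h0 : ∀ i, a i = 0 := by
      intro i
      have h1 : ∑ i, a i ^ 2 = 0 := le_antisymm (by simpa using ha)
        (Finset.sum_nonneg fun i (_ : i ∈ Finset.univ) => sq_nonneg (a i))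
      have := (Finset.sum_eq_zero_iff_of_nonneg (fun i _ => sq_nonneg (a i))).1 h1 i
        (Finset.mem_univ i)
      exact pow_eq_zero_iff two_ne_zero |>.1 this
    simp [h0]
  set x := 2 * √(Real.log n) * β with hxdef
  have hlog : 0 ≤ Real.log n := Real.log_nonneg (by exact_mod_cast hn)
  have hx : 0 ≤ x := by positivity
  have hx2 : x ^ 2 = 4 * Real.log n * β ^ 2 := by
    rw [hxdef, mul_pow, mul_pow, Real.sq_sqrt hlog]; ring
  have tail : ∀ b : Vec n, ∑ i, b i ^ 2 ≤ β ^ 2 →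
      gaussianLaw μ {y | x < ∑ i, b i * (y i - μ i)} ≤ ENNReal.ofReal (1 / (n : ℝ) ^ 2) := by
    intro b hb
    rcases (Finset.sum_nonneg fun i _ => sq_nonneg (b i) : 0 ≤ ∑ i, b i ^ 2).eq_or_lt with h0 | h0
    · have h0' : ∀ i, b i = 0 := by
        intro i
        have := (Finset.sum_eq_zero_iff_of_nonneg (fun i _ => sq_nonneg (b i))).1 h0.symm i
          (Finset.mem_univ i)
        exact pow_eq_zero_iff two_ne_zero |>.1 this
      simp [h0', not_lt.2 hx]
    · have h1 := gaussianLaw_sum_ge_le μ b hx rfl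
      -- The threshold `2 √(log n) β` makes the exponent at most `-2 log n`; the resulting `n⁻²`
      -- survives a union bound over `2n` forms.
      have h2 : Real.exp (-x ^ 2 / (2 * ∑ i, b i ^ 2)) ≤ 1 / (n : ℝ) ^ 2 := by
        have h3 : 1 / (n : ℝ) ^ 2 = Real.exp (-(2 * Real.log n)) := by
          rw [Real.exp_neg, one_div, two_mul, Real.exp_add, Real.exp_log hn0, sq]
        rw [h3, Real.exp_le_exp, neg_div, neg_le_neg_iff, hx2, le_div_iff₀ (by positivity)]
        nlinarith
      have h4 : gaussianLaw μ {y | x < ∑ i, b i * (y i - μ i)} ≤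
          gaussianLaw μ {y | x ≤ ∑ i, b i * (y i - μ i)} :=
        measure_mono fun y (hy : x < _) => hy.le
      refine h4.trans ?_
      rw [← ofReal_measureReal]
      exact ENNReal.ofReal_le_ofReal (h1.trans h2)
  have hsub : {y : Vec n | x < |∑ i, a i * (y i - μ i)|} ⊆
      {y | x < ∑ i, a i * (y i - μ i)} ∪ {y | x < ∑ i, (-a) i * (y i - μ i)} := by
    intro y hy
    rcases lt_abs.1 (show x < |∑ i, a i * (y i - μ i)| from hy) with h | h
    · exact Or.inl h
    · right
      simpa [Finset.sum_neg_distrib] using h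
  calc _ ≤ _ := measure_mono hsub
    _ ≤ _ := measure_union_le _ _
    _ ≤ ENNReal.ofReal (1 / (n : ℝ) ^ 2) + ENNReal.ofReal (1 / (n : ℝ) ^ 2) :=
      add_le_add (tail a ha) (tail (-a) (by simpa using ha))
    _ = ENNReal.ofReal (2 / (n : ℝ) ^ 2) := by
      rw [← ENNReal.ofReal_add (by positivity) (by positivity)]; congr 1; ring

/-- Simultaneous control of finitely many Gaussian linear forms. -/
lemma gaussianLaw_exists_abs_sum_gt_le {n : ℕ} (hn : 1 ≤ n) {J : Type*} [Fintype J] (μ : Vec n)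
    (a : J → Vec n) (β : J → ℝ) (hβ : ∀ j, 0 ≤ β j) (ha : ∀ j, ∑ i, a j i ^ 2 ≤ β j ^ 2)
    (hJ : Fintype.card J ≤ 2 * n) :
    gaussianLaw μ {y | ∃ j, 2 * √(Real.log n) * β j < |∑ i, a j i * (y i - μ i)|} ≤
      ENNReal.ofReal (4 / (n : ℝ)) := by
  have hn0 : (0 : ℝ) < n := by exact_mod_cast hn
  have hset : {y : Vec n | ∃ j, 2 * √(Real.log n) * β j < |∑ i, a j i * (y i - μ i)|} =
      ⋃ j, {y | 2 * √(Real.log n) * β j < |∑ i, a j i * (y i - μ i)|} := by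
    ext y; simp
  rw [hset]
  calc _ ≤ ∑ j, gaussianLaw μ {y | 2 * √(Real.log n) * β j < |∑ i, a j i * (y i - μ i)|} :=
        measure_iUnion_fintype_le _ _
    _ ≤ ∑ _j : J, ENNReal.ofReal (2 / (n : ℝ) ^ 2) :=
        Finset.sum_le_sum fun j _ => gaussianLaw_abs_sum_gt_le hn μ (a j) (hβ j) (ha j)
    _ = ENNReal.ofReal (Fintype.card J * (2 / (n : ℝ) ^ 2)) := by
        rw [Finset.sum_const, Finset.card_univ, nsmul_eq_mul, ENNReal.ofReal_mul (by positivity)]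
        simp
    _ ≤ ENNReal.ofReal (4 / (n : ℝ)) := by
        refine ENNReal.ofReal_le_ofReal ?_
        have hJ' : (Fintype.card J : ℝ) ≤ 2 * n := by exact_mod_cast hJ
        calc (Fintype.card J : ℝ) * (2 / (n : ℝ) ^ 2) ≤ 2 * (n : ℝ) * (2 / (n : ℝ) ^ 2) := by gcongr
          _ = 4 / (n : ℝ) := by field_simp; ring


/-! ### Splitting the noise along the kernel of the retained rows. -/

lemma sum_mul_eq_inner {ι : Type*} [Fintype ι] (x y : EuclideanSpace ℝ ι) :
    ∑ i, x i * y i = inner ℝ x y := by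
  rw [PiLp.inner_apply]
  exact Finset.sum_congr rfl fun i _ => mul_comm _ _

/-- Linear forms controlling the inner product with a noise vector by the `ℓ²`-norm of `h` and the
weighted `ℓ¹`-norm of `D h`, given a right inverse `ψ` of `D`. -/
theorem exists_noise_forms {ι I J : Type*} [Fintype ι] [Fintype I] [Fintype J] [DecidableEq J]
    (D : (ι → ℝ) →ₗ[ℝ] (J → ℝ)) (G : (ι → ℝ) →ₗ[ℝ] (I → ℝ))
    (hDG : ∀ h, D h = 0 → G h = 0 → h = 0) (ψ : J → ι → ℝ) (hψ : ∀ j, D (ψ j) = Pi.single j 1) :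
    ∃ (d : ℕ) (a : Fin d → ι → ℝ) (a' : J → ι → ℝ), d ≤ Fintype.card I ∧ d ≤ Fintype.card ι ∧
      (∀ i, ∑ x, a i x ^ 2 = 1) ∧ (∀ j, ∑ x, a' j x ^ 2 ≤ ∑ x, ψ j x ^ 2) ∧
      ∀ (ε h : ι → ℝ) (τ : ℝ) (β : J → ℝ), 0 ≤ τ → (∀ i, |∑ x, a i x * ε x| ≤ τ) →
        (∀ j, |∑ x, a' j x * ε x| ≤ β j) →
        ∑ x, ε x * h x ≤ √(Fintype.card I) * τ * √(∑ x, h x ^ 2) + ∑ j, β j * |D h j| := by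
  classical
  let e := WithLp.linearEquiv 2 ℝ (ι → ℝ)
  let V : Submodule ℝ (EuclideanSpace ℝ ι) := LinearMap.ker (D ∘ₗ e.toLinearMap)
  have hV : ∀ v : EuclideanSpace ℝ ι, v ∈ V ↔ D v.ofLp = 0 := fun v => Iff.rfl
  let u := stdOrthonormalBasis ℝ V
  have hnorm : ∀ x : EuclideanSpace ℝ ι, ∑ i, x i ^ 2 = ‖x‖ ^ 2 := fun x => by
    rw [EuclideanSpace.real_norm_sq_eq]
  have hinj : Function.Injective (G ∘ₗ e.toLinearMap ∘ₗ V.subtype) := by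
    rw [← LinearMap.ker_eq_bot, LinearMap.ker_eq_bot']
    intro v hv
    have h1 := hDG (v : EuclideanSpace ℝ ι).ofLp ((hV _).1 v.2) hv
    exact Subtype.ext (by ext i; exact congrFun h1 i)
  have hd : Module.finrank ℝ V ≤ Fintype.card I := by
    simpa using LinearMap.finrank_le_finrank_of_injective hinj
  have hd' : Module.finrank ℝ V ≤ Fintype.card ι := by
    simpa using Submodule.finrank_le V
  let ψ' : J → EuclideanSpace ℝ ι := fun j => WithLp.toLp 2 (ψ j)
  -- The forms are an orthonormal basis of `V = ker D` and the residuals of the `ψ j` after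
  -- projection onto `V`; projecting only shrinks norms.
  refine ⟨Module.finrank ℝ V, fun i => ((u i : V) : EuclideanSpace ℝ ι).ofLp,
    fun j => (ψ' j - V.starProjection (ψ' j)).ofLp, hd, hd', fun i => ?_, fun j => ?_, ?_⟩
  · rw [hnorm, ← Submodule.coe_norm, u.norm_eq_one, one_pow]
  · have h1 : ∑ x, ψ j x ^ 2 = ‖ψ' j‖ ^ 2 := hnorm (ψ' j)
    rw [hnorm, h1, ← Submodule.starProjection_orthogonal_val]
    exact pow_le_pow_left₀ (norm_nonneg _) (Submodule.norm_starProjection_apply_le _ _) 2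
  · intro ε h τ β hτ ha ha'
    set E : EuclideanSpace ℝ ι := WithLp.toLp 2 ε with hE
    set H : EuclideanSpace ℝ ι := WithLp.toLp 2 h with hH
    -- Since `ψ` is a right inverse of `D`, `H - ∑ D h j • ψ' j` lies in `V` and is fixed by the
    -- projection.
    have hdec : H = V.starProjection H + ∑ j, D h j • (ψ' j - V.starProjection (ψ' j)) := by
      have h1 : H - ∑ j, D h j • ψ' j ∈ V := by
        rw [hV]
        have : (H - ∑ j, D h j • ψ' j).ofLp = h - ∑ j, D h j • ψ j := by
          simp [hH, ψ']
        rw [this, map_sub, map_sum]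
        simp_rw [map_smul, hψ]
        ext j
        simp [Finset.sum_apply, Pi.single_apply]
      have h2 := Submodule.starProjection_eq_self_iff.2 h1
      rw [map_sub, map_sum] at h2
      simp_rw [map_smul] at h2
      simp_rw [smul_sub, Finset.sum_sub_distrib]
      rw [sub_eq_iff_eq_add] at h2
      rw [h2]
      abel
    have hproj : V.starProjection H =
        ∑ i, inner ℝ ((u i : V) : EuclideanSpace ℝ ι) H • ((u i : V) : EuclideanSpace ℝ ι) := by
      rw [Submodule.starProjection_apply, u.orthogonalProjectionOnto_apply_eq_sum]
      simp
    have hEH : ∑ x, ε x * h x = ∑ i, inner ℝ ((u i : V) : EuclideanSpace ℝ ι) H *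
        inner ℝ ((u i : V) : EuclideanSpace ℝ ι) E +
          ∑ j, D h j * inner ℝ (ψ' j - V.starProjection (ψ' j)) E := by
      have : ∑ x, ε x * h x = inner ℝ H E := by
        rw [← sum_mul_eq_inner]
        exact Finset.sum_congr rfl fun i _ => mul_comm _ _
      rw [this]
      conv_lhs => rw [hdec, hproj]
      rw [inner_add_left, sum_inner, sum_inner]
      simp_rw [real_inner_smul_left]
    rw [hEH]
    have ha1 : ∀ i, |inner ℝ ((u i : V) : EuclideanSpace ℝ ι) E| ≤ τ := fun i => by
      rw [← sum_mul_eq_inner]; exact ha i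
    have ha2 : ∀ j, |inner ℝ (ψ' j - V.starProjection (ψ' j)) E| ≤ β j := fun j => by
      rw [← sum_mul_eq_inner]; exact ha' j
    refine add_le_add ?_ (Finset.sum_le_sum fun j _ => ?_)
    · have hon : Orthonormal ℝ (fun i => ((u i : V) : EuclideanSpace ℝ ι)) :=
        u.orthonormal.comp_linearIsometry V.subtypeₗᵢ
      have hbessel := hon.sum_inner_products_le H (s := Finset.univ)
      have hcs := Real.sum_mul_le_sqrt_mul_sqrt Finset.univ
        (fun i => inner ℝ ((u i : V) : EuclideanSpace ℝ ι) E)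
        (fun i => inner ℝ ((u i : V) : EuclideanSpace ℝ ι) H)
      calc _ = ∑ i, inner ℝ ((u i : V) : EuclideanSpace ℝ ι) E *
            inner ℝ ((u i : V) : EuclideanSpace ℝ ι) H :=
            Finset.sum_congr rfl fun i _ => mul_comm _ _
        _ ≤ _ := hcs
        _ ≤ √(Fintype.card I * τ ^ 2) * √(∑ x, h x ^ 2) := by
            gcongr
            · calc _ ≤ ∑ _i : Fin (Module.finrank ℝ V), τ ^ 2 := Finset.sum_le_sum fun i _ => by
                    rw [← sq_abs]; exact pow_le_pow_left₀ (abs_nonneg _) (ha1 i) 2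
                _ = (Module.finrank ℝ V : ℝ) * τ ^ 2 := by simp
                _ ≤ _ := by
                    gcongr
            · have h1 : ∑ x, h x ^ 2 = ‖H‖ ^ 2 := hnorm H
              rw [h1]
              simpa using hbessel
        _ = _ := by rw [Real.sqrt_mul (by positivity), Real.sqrt_sq hτ]
    · calc _ ≤ |D h j * inner ℝ (ψ' j - V.starProjection (ψ' j)) E| := le_abs_self _
        _ = |inner ℝ (ψ' j - V.starProjection (ψ' j)) E| * |D h j| := by rw [abs_mul, mul_comm]
        _ ≤ _ := by gcongr; exact ha2 j


/-! ### The multi-scale bump. -/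

/-- Each difference costs one application of the mean value inequality and gains one factor `h`. -/
lemma abs_fwdDiff_iter_le {k : ℕ} {F : ℝ → ℝ} {C h : ℝ} (hF : ContDiff ℝ k F)
    (hC : ∀ x, |iteratedDeriv k F x| ≤ C) (hh : 0 ≤ h) (x : ℝ) :
    |(fwdDiff h)^[k] F x| ≤ C * h ^ k := by
  induction k generalizing F C with
  | zero => simpa using hC x
  | succ k ih =>
    rw [Function.iterate_succ_apply]
    have hk : ContDiff ℝ k F := hF.of_le (by exact_mod_cast Nat.le_succ k)
    have hshift : ContDiff ℝ k (fun x => F (x + h)) := hk.comp (contDiff_id.add contDiff_const)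
    have hG : ContDiff ℝ k (fwdDiff h F) := hshift.sub hk
    have hdiff : Differentiable ℝ (iteratedDeriv k F) :=
      hF.differentiable_iteratedDeriv k (by exact_mod_cast Nat.lt_succ_self k)
    have hbd : ∀ x, |iteratedDeriv k (fwdDiff h F) x| ≤ C * h := by
      intro x
      have h1 : iteratedDeriv k (fwdDiff h F) x =
          iteratedDeriv k F (x + h) - iteratedDeriv k F x := by
        have := iteratedDeriv_fun_sub (hshift.contDiffAt (x := x)) hk.contDiffAt
        rw [iteratedDeriv_comp_add_const] at this
        exact this
      rw [h1]
      have := Convex.norm_image_sub_le_of_norm_deriv_le (f := iteratedDeriv k F) (s := Set.univ)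
        (x := x) (y := x + h) (C := C) (fun y _ => hdiff y)
        (fun y _ => by rw [← iteratedDeriv_succ]; exact hC y) convex_univ trivial trivial
      simpa [abs_of_nonneg hh] using this
    refine (ih hG hbd).trans (le_of_eq ?_)
    rw [pow_succ]; ring

lemma fwdDiff_iter_comp_mul (k : ℕ) (η : ℝ → ℝ) (c : ℝ) (y : ℤ) :
    (fwdDiff (1 : ℤ))^[k] (fun y : ℤ => η (c * y)) y = (fwdDiff c)^[k] η (c * y) := by
  rw [fwdDiff_iter_eq_sum_shift, fwdDiff_iter_eq_sum_shift]
  refine Finset.sum_congr rfl fun r _ => ?_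
  congr 2
  simp only [nsmul_eq_mul, mul_one]
  push_cast
  ring

lemma exists_smooth_bump (k : ℕ) : ∃ η : ℝ → ℝ, ContDiff ℝ k η ∧ η 0 = 1 ∧ (∀ x, 0 ≤ η x) ∧
    (∀ x, η x ≤ 1) ∧ (∀ x, 1 ≤ |x| → η x = 0) ∧
    ∃ C : ℝ, 0 < C ∧ ∀ x, |iteratedDeriv k η x| ≤ C := by
  let η : ContDiffBump (0 : ℝ) := ⟨1 / 2, 1, by norm_num, by norm_num⟩
  have hη : ContDiff ℝ k η := by exact_mod_cast η.contDiff (n := k)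
  refine ⟨η, hη, ?_, fun x => η.nonneg, fun x => η.le_one, fun x hx => ?_, ?_⟩
  · exact η.one_of_mem_closedBall (by simp [η])
  · exact η.zero_of_le_dist (by simpa [η] using hx)
  · have hc : HasCompactSupport (iteratedFDeriv ℝ k η) := η.hasCompactSupport.iteratedFDeriv k
    obtain ⟨C, hC⟩ := hc.exists_bound_of_continuous (hη.continuous_iteratedFDeriv le_rfl)
    refine ⟨max C 1, by positivity, fun x => ?_⟩
    have := hC x
    rw [norm_iteratedFDeriv_eq_norm_iteratedDeriv] at this
    exact this.trans (le_max_left _ _)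

/-- A geometric sum is dominated by its last term; the factor `4` works because `4 ≤ 3 √2`. -/
lemma sum_sqrt_two_pow_le (N : ℕ) (x : ℝ) :
    ∑ l ∈ (Finset.range N).filter (fun l => (2 : ℝ) ^ l ≤ x), √2 ^ l ≤ 4 * √x := by
  have hs : (4 / 3 : ℝ) ≤ √2 := Real.le_sqrt_of_sq_le (by norm_num)
  have hgeom : ∀ N : ℕ, ∑ l ∈ Finset.range (N + 1), √2 ^ l ≤ 4 * √2 ^ N := by
    intro N
    induction N with
    | zero => simp
    | succ N ih =>
      rw [Finset.sum_range_succ]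
      have : 0 < √2 ^ N := by positivity
      rw [pow_succ]
      nlinarith
  induction N with
  | zero => simp
  | succ N ih =>
    by_cases h : (2 : ℝ) ^ N ≤ x
    · calc _ ≤ ∑ l ∈ Finset.range (N + 1), √2 ^ l :=
            Finset.sum_le_sum_of_subset_of_nonneg (Finset.filter_subset _ _)
              fun _ _ _ => by positivity
        _ ≤ 4 * √2 ^ N := hgeom N
        _ ≤ 4 * √x := by
            gcongr
            refine Real.le_sqrt_of_sq_le ?_
            rwa [← pow_mul, mul_comm, pow_mul, Real.sq_sqrt (by norm_num)]
    · rw [Finset.range_add_one, Finset.filter_insert, if_neg h]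
      exact ih

lemma sum_inv_abs_add_one_le {x : ℝ} (hx : 1 ≤ x) (Y : Finset ℤ) :
    ∑ y ∈ Y.filter (fun y : ℤ => |(y : ℝ)| + 1 ≤ x), (|(y : ℝ)| + 1)⁻¹ ≤ 2 * (1 + Real.log x) := by
  classical
  set N := ⌊x⌋₊
  have hharm : ∑ i ∈ Finset.range N, ((i : ℝ) + 1)⁻¹ ≤ 1 + Real.log x := by
    have h1 := harmonic_le_one_add_log N
    have h2 : Real.log N ≤ Real.log x :=
      Real.log_le_log (by exact_mod_cast Nat.floor_pos.2 hx) (Nat.floor_le (by linarith))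
    have h3 : ((harmonic N : ℚ) : ℝ) = ∑ i ∈ Finset.range N, ((i : ℝ) + 1)⁻¹ := by
      simp [harmonic]
    rw [← h3]
    linarith
  have hsub : Y.filter (fun y : ℤ => |(y : ℝ)| + 1 ≤ x) ⊆
      (Finset.range N).image (fun i : ℕ => (i : ℤ)) ∪
        (Finset.range N).image (fun i : ℕ => -(i : ℤ)) := by
    intro y hy
    rw [Finset.mem_filter] at hy
    have h1 : y.natAbs + 1 ≤ N := by
      refine Nat.le_floor ?_
      push_cast
      rw [Nat.cast_natAbs]
      push_cast
      exact hy.2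
    simp only [Finset.mem_union, Finset.mem_image, Finset.mem_range]
    rcases le_total 0 y with h | h
    · exact Or.inl ⟨y.natAbs, by omega, by omega⟩
    · exact Or.inr ⟨y.natAbs, by omega, by omega⟩
  calc _ ≤ _ := Finset.sum_le_sum_of_subset_of_nonneg hsub fun _ _ _ => by positivity
    _ ≤ ∑ y ∈ (Finset.range N).image (fun i : ℕ => (i : ℤ)), (|(y : ℝ)| + 1)⁻¹ +
        ∑ y ∈ (Finset.range N).image (fun i : ℕ => -(i : ℤ)), (|(y : ℝ)| + 1)⁻¹ := by
      rw [← Finset.sum_union_inter]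
      exact le_add_of_nonneg_right (Finset.sum_nonneg fun _ _ => by positivity)
    _ = ∑ i ∈ Finset.range N, ((i : ℝ) + 1)⁻¹ + ∑ i ∈ Finset.range N, ((i : ℝ) + 1)⁻¹ := by
      rw [Finset.sum_image (by intro a _ b _ h; simpa using h),
        Finset.sum_image (by intro a _ b _ h; simpa using h)]
      simp
    _ ≤ _ := by linarith

lemma exists_two_pow_near {b z : ℝ} (hz : 0 < z) (hzb : z ≤ b) :
    ∃ l : ℕ, b < 2 ^ l * z ∧ 2 ^ l * z ≤ 2 * b := by
  obtain ⟨m, h1, h2⟩ := exists_nat_pow_near ((one_le_div hz).2 hzb) (one_lt_two)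
  rw [le_div_iff₀ hz] at h1
  rw [div_lt_iff₀ hz] at h2
  exact ⟨m + 1, h2, by rw [pow_succ]; linarith⟩

/-- A multi-scale bump of width `b`: it peaks at `0` like `1 - |y / b| ^ (k - 1/2)`, and the energy
of its `k`-th differences is of order `log b / b ^ (2 k - 1)`. -/
theorem exists_interpolating_bump {k : ℕ} (hk : 1 ≤ k) : ∃ c C : ℝ, 0 < c ∧ 0 < C ∧
    ∀ b : ℝ, 1 ≤ b → ∃ φ : ℤ → ℝ, φ 0 = 1 ∧ (∀ y, 0 ≤ φ y) ∧ (∀ y : ℤ, b ≤ |(y : ℝ)| → φ y = 0) ∧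
      (∀ y : ℤ, |(y : ℝ)| ≤ b → φ y ≤ 1 - c * √((|(y : ℝ)| / b) ^ (2 * k - 1))) ∧
      ∀ Y : Finset ℤ, ∑ y ∈ Y, ((fwdDiff (1 : ℤ))^[k] φ y) ^ 2 ≤
        C * (1 + Real.log b) / b ^ (2 * k - 1) := by
  obtain ⟨p, rfl⟩ : ∃ p, k = p + 1 := ⟨k - 1, by omega⟩
  have hp : 2 * (p + 1) - 1 = 2 * p + 1 := by omega
  rw [hp]
  obtain ⟨η, hηd, hη0, hηnn, hηle, hηz, C₀, hC₀, hηC⟩ := exists_smooth_bump (p + 1)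
  -- `r = 2^(-(k - 1/2))`: weights `r ^ l` on bumps of width `b / 2 ^ l` create the cusp of order `k
  -- - 1/2`.
  set r : ℝ := √((1 / 2) ^ (2 * p + 1)) with hr
  have hr0 : 0 < r := by positivity
  have hr2 : r ^ 2 = (1 / 2) ^ (2 * p + 1) := Real.sq_sqrt (by positivity)
  have hr34 : r ≤ 3 / 4 := by
    have : r ^ 2 ≤ 1 / 2 := by
      rw [hr2]
      exact (pow_le_pow_of_le_one (by norm_num) (by norm_num) (by omega : 1 ≤ 2 * p + 1)).trans
        (by norm_num)
    nlinarith
  have hrs : r * 2 ^ (p + 1) = √2 := by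
    rw [eq_comm, Real.sqrt_eq_iff_mul_self_eq (by norm_num) (by positivity)]
    have : r * 2 ^ (p + 1) * (r * 2 ^ (p + 1)) = r ^ 2 * (2 ^ (p + 1)) ^ 2 := by ring
    rw [this, hr2, ← pow_mul, div_pow, one_pow, show (p + 1) * 2 = (2 * p + 1) + 1 by ring]
    field_simp
    ring
  set K : ℝ := 2 * (p + 1 : ℕ) + 3 with hK
  have hK1 : 1 ≤ K := by
    have : (0 : ℝ) ≤ (p + 1 : ℕ) := by positivity
    rw [hK]; linarith
  refine ⟨r / 4, 32 * C₀ ^ 2 * K * (1 + Real.log K), by positivity,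
    by have := Real.log_nonneg hK1; positivity, fun b hb => ?_⟩
  have hb0 : 0 < b := by linarith
  -- `b < 2 ^ L ≤ 2 b`: the finest scale is about one lattice step.
  obtain ⟨L, hL1, hL2⟩ := exists_two_pow_near one_pos hb
  rw [mul_one] at hL1 hL2
  set W := ∑ l ∈ Finset.range (L + 1), r ^ l with hW
  have hW1 : 1 ≤ W := by
    rw [hW, Finset.sum_range_succ']
    have : 0 ≤ ∑ l ∈ Finset.range L, r ^ (l + 1) := Finset.sum_nonneg fun _ _ => by positivity
    simpa using this
  have hW4 : W ≤ 4 := by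
    have h1 := geom_sum_mul_neg r (L + 1)
    have h2 : 0 < r ^ (L + 1) := by positivity
    nlinarith
  let ζ : ℕ → ℤ → ℝ := fun l y => η (2 ^ l / b * y)
  let φ : ℤ → ℝ := fun y => ∑ l ∈ Finset.range (L + 1), (r ^ l / W) * ζ l y
  have hw : ∑ l ∈ Finset.range (L + 1), r ^ l / W = 1 := by
    rw [← Finset.sum_div, div_self (by linarith)]
  -- `φ` is a convex combination of bumps bounded by one, so a vanishing scale costs its full
  -- weight.
  have hφle : ∀ y, ∀ l ∈ Finset.range (L + 1), ζ l y = 0 → φ y ≤ 1 - r ^ l / W := by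
    intro y l hl h0
    rw [← hw, ← Finset.sum_erase_add _ _ hl]
    simp only [φ]
    rw [← Finset.sum_erase_add _ _ hl, h0, mul_zero, add_zero, add_sub_cancel_right]
    exact Finset.sum_le_sum fun i _ => mul_le_of_le_one_right (by positivity) (hηle _)
  have hζ0 : ∀ l (y : ℤ), b ≤ 2 ^ l * |(y : ℝ)| → ζ l y = 0 := by
    intro l y h
    refine hηz _ ?_
    rw [abs_mul, abs_of_pos (by positivity : (0 : ℝ) < 2 ^ l / b), div_mul_eq_mul_div,
      one_le_div hb0]
    exact h
  refine ⟨φ, ?_, fun y => Finset.sum_nonneg fun l _ => mul_nonneg (by positivity) (hηnn _), ?_, ?_,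
    ?_⟩
  · simp only [φ, ζ, Int.cast_zero, mul_zero, hη0, mul_one]
    exact hw
  · intro y hy
    refine Finset.sum_eq_zero fun l _ => ?_
    rw [hζ0 l y, mul_zero]
    exact hy.trans (le_mul_of_one_le_left (abs_nonneg _) (one_le_pow₀ (by norm_num)))
  · intro y hy
    rcases eq_or_ne y 0 with rfl | hy0
    · simp only [Int.cast_zero, abs_zero, zero_div]
      rw [zero_pow (by omega), Real.sqrt_zero, mul_zero, sub_zero]
      simp only [φ, ζ, Int.cast_zero, mul_zero, hη0, mul_one]
      exact hw.le
    · have hy1 : (1 : ℝ) ≤ |(y : ℝ)| := by exact_mod_cast Int.one_le_abs hy0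
      -- This scale already vanishes at `y`, yet `2 ^ l` is at most `2 b / |y|`, so its weight is at
      -- least `r (|y| / b)^(k - 1/2)`.
      obtain ⟨l, hl1, hl2⟩ := exists_two_pow_near (by linarith) hy
      have hlL : l ≤ L := by
        by_contra! hlt
        have h1 : (2 : ℝ) ^ (L + 1) ≤ 2 ^ l := pow_le_pow_right₀ (by norm_num) hlt
        rw [pow_succ] at h1
        have h2 : (2 : ℝ) ^ l ≤ 2 ^ l * |(y : ℝ)| := le_mul_of_one_le_right (by positivity) hy1
        linarith
      refine (hφle y l (Finset.mem_range.2 (by omega)) (hζ0 l y hl1.le)).trans ?_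
      have h1 : r * √((|(y : ℝ)| / b) ^ (2 * p + 1)) ≤ r ^ l := by
        have h3 : r ^ l = √(((1 / 2) ^ l) ^ (2 * p + 1)) := by
          rw [eq_comm, Real.sqrt_eq_iff_mul_self_eq (by positivity) (by positivity), ← sq,
            ← pow_mul, ← pow_mul, mul_comm l 2, pow_mul r, hr2, ← pow_mul, mul_comm]
        rw [h3, hr, ← Real.sqrt_mul (by positivity), ← mul_pow]
        refine Real.sqrt_le_sqrt (pow_le_pow_left₀ (by positivity) ?_ _)
        rw [one_div, inv_pow, ← one_div, ← one_div, div_mul_div_comm, one_mul,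
          div_le_div_iff₀ (by positivity) (by positivity)]
        linarith
      have h2 : r ^ l / 4 ≤ r ^ l / W := by gcongr
      linarith
  · intro Y
    -- Scale `l` contributes at `y` only if its support, widened by `k`, reaches `y`; `K = 2k + 3`
    -- accounts for the widening.
    have hterm : ∀ l ∈ Finset.range (L + 1), ∀ y : ℤ, |(fwdDiff (1 : ℤ))^[p + 1] (ζ l) y| ≤
        if (2 : ℝ) ^ l ≤ K * b / (|(y : ℝ)| + 1) then C₀ * (2 ^ l / b) ^ (p + 1) else 0 := by
      intro l hl y
      split_ifs with h
      · simp only [ζ]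
        rw [fwdDiff_iter_comp_mul]
        exact abs_fwdDiff_iter_le hηd hηC (by positivity) _
      · rw [fwdDiff_iter_eq_zero, abs_zero]
        intro i hi
        refine hζ0 l _ ?_
        by_contra! hlt
        apply h
        rw [le_div_iff₀ (by positivity)]
        rw [Finset.mem_range] at hi
        have hi' : (i : ℝ) ≤ (p + 1 : ℕ) := by exact_mod_cast (by omega : i ≤ p + 1)
        have h3 : |(y : ℝ)| ≤ |((y + i : ℤ) : ℝ)| + i := by
          have := abs_sub ((y + i : ℤ) : ℝ) i
          simpa using this
        have h4 : (2 : ℝ) ^ l ≤ 2 * b :=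
          (pow_le_pow_right₀ (by norm_num) (by rw [Finset.mem_range] at hl; omega)).trans hL2
        calc (2 : ℝ) ^ l * (|(y : ℝ)| + 1)
            ≤ 2 ^ l * (|((y + i : ℤ) : ℝ)| + (p + 1 : ℕ) + 1) := by gcongr; linarith
          _ = 2 ^ l * |((y + i : ℤ) : ℝ)| + 2 ^ l * ((p + 1 : ℕ) + 1) := by ring
          _ ≤ b + 2 * b * ((p + 1 : ℕ) + 1) := by gcongr
          _ = K * b := by rw [hK]; ring
    -- As `r * 2 ^ k = √2`, the scales add up to order `b^(-k) √(b / (|y| + 1))`. Squaring leaves a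
    -- harmonic sum, hence a single logarithm.
    have hpt : ∀ y : ℤ, |(fwdDiff (1 : ℤ))^[p + 1] φ y| ≤
        C₀ / b ^ (p + 1) * ∑ l ∈ (Finset.range (L + 1)).filter
          (fun l => (2 : ℝ) ^ l ≤ K * b / (|(y : ℝ)| + 1)), √2 ^ l := by
      intro y
      have h1 : (fwdDiff (1 : ℤ))^[p + 1] φ y = ∑ l ∈ Finset.range (L + 1),
          (r ^ l / W) * (fwdDiff (1 : ℤ))^[p + 1] (ζ l) y := by
        have h2 : φ = ∑ l ∈ Finset.range (L + 1), (r ^ l / W) • ζ l := by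
          ext y; simp [φ]
        rw [h2, fwdDiff_iter_finsetSum, Finset.sum_apply]
        refine Finset.sum_congr rfl fun l _ => ?_
        rw [fwdDiff_iter_const_smul]
        rfl
      rw [h1, Finset.sum_filter, Finset.mul_sum]
      refine (Finset.abs_sum_le_sum_abs _ _).trans (Finset.sum_le_sum fun l hl => ?_)
      rw [abs_mul, abs_of_nonneg (by positivity : 0 ≤ r ^ l / W)]
      have h3 : r ^ l / W ≤ r ^ l := div_le_self (by positivity) hW1
      calc _ ≤ r ^ l * _ := mul_le_mul h3 (hterm l hl y) (abs_nonneg _) (by positivity)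
        _ = _ := by
          split_ifs
          · rw [← hrs]
            simp only [div_pow, mul_pow, ← pow_mul]
            rw [mul_comm l (p + 1)]
            ring
          · simp
    have hsq : ∀ y ∈ Y, ((fwdDiff (1 : ℤ))^[p + 1] φ y) ^ 2 ≤
        if |(y : ℝ)| + 1 ≤ K * b then
          16 * C₀ ^ 2 * K / b ^ (2 * p + 1) * (|(y : ℝ)| + 1)⁻¹ else 0 := by
      intro y _
      have hy0 : 0 < |(y : ℝ)| + 1 := by positivity
      split_ifs with h
      · have h1 := (hpt y).trans (mul_le_mul_of_nonneg_left
          (sum_sqrt_two_pow_le (L + 1) (K * b / (|(y : ℝ)| + 1)))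
          (by positivity))
        have h2 := pow_le_pow_left₀ (abs_nonneg _) h1 2
        rw [sq_abs] at h2
        refine h2.trans (le_of_eq ?_)
        rw [mul_pow, mul_pow, Real.sq_sqrt (by positivity)]
        field_simp
        ring
      · have h1 := hpt y
        rw [Finset.filter_false_of_mem, Finset.sum_empty, mul_zero] at h1
        · rw [abs_nonpos_iff.1 h1]; simp
        · intro l _ h2
          rw [le_div_iff₀ hy0] at h2
          exact h ((le_mul_of_one_le_left hy0.le (one_le_pow₀ (by norm_num))).trans h2)
    have hlogb : 0 ≤ Real.log b := Real.log_nonneg hb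
    have hlogK : 0 ≤ Real.log K := Real.log_nonneg hK1
    calc _ ≤ _ := Finset.sum_le_sum hsq
      _ = 16 * C₀ ^ 2 * K / b ^ (2 * p + 1) *
          ∑ y ∈ Y.filter (fun y : ℤ => |(y : ℝ)| + 1 ≤ K * b), (|(y : ℝ)| + 1)⁻¹ := by
        rw [← Finset.sum_filter, Finset.mul_sum]
      _ ≤ 16 * C₀ ^ 2 * K / b ^ (2 * p + 1) * (2 * (1 + Real.log (K * b))) := by
        gcongr
        exact sum_inv_abs_add_one_le (by nlinarith) Y
      _ ≤ 16 * C₀ ^ 2 * K / b ^ (2 * p + 1) * (2 * ((1 + Real.log K) * (1 + Real.log b))) := by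
        gcongr
        rw [Real.log_mul (by positivity) hb0.ne']
        nlinarith
      _ = _ := by ring


/-! ### Knot geometry and localised Green functions. -/

lemma IsKnots.mono {k n s : ℕ} {t : ℕ → ℕ} (ht : IsKnots k n s t) {i i' : ℕ} (h : i ≤ i')
    (hi' : i' ≤ s + 1) : t i ≤ t i' := by
  induction i', h using Nat.le_induction with
  | base => rfl
  | succ m _ ih => exact (ih (by omega)).trans (ht.2.2 m (by omega)).le

lemma IsKnots.segLen_eq {k n s : ℕ} {t : ℕ → ℕ} (ht : IsKnots k n s t) {i : ℕ} (hi : i ≤ s) :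
    t (i + 1) = t i + segLen t (i + 1) := by
  have := ht.2.2 i hi
  simp only [segLen, Nat.add_sub_cancel]
  omega

lemma minLen_le {s : ℕ} (t : ℕ → ℕ) {i : ℕ} (hi : i ≤ s) : minLen s t ≤ segLen t (i + 1) :=
  Finset.inf'_le _ (by simp only [Finset.mem_Icc]; omega)

lemma le_maxLen {s : ℕ} (t : ℕ → ℕ) {i : ℕ} (hi : i ≤ s) : segLen t (i + 1) ≤ maxLen s t :=
  Finset.le_sup' (segLen t) (by simp only [Finset.mem_Icc]; omega)

lemma IsKnots.add_minLen_le {k n s : ℕ} {t : ℕ → ℕ} (ht : IsKnots k n s t) {i i' : ℕ} (h : i < i')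
    (hi' : i' ≤ s + 1) : t i + minLen s t ≤ t i' := by
  have h1 := ht.segLen_eq (i := i) (by omega)
  have h2 := minLen_le t (s := s) (i := i) (by omega)
  have h3 := ht.mono (i := i + 1) h hi'
  omega

lemma IsKnots.mul_minLen_le {k n s : ℕ} {t : ℕ → ℕ} (ht : IsKnots k n s t) :
    k + (s + 1) * minLen s t ≤ n + 1 := by
  have : ∀ i ≤ s + 1, k + i * minLen s t ≤ t i := by
    intro i hi
    induction i with
    | zero => simp [ht.1]
    | succ i ih =>
      have h1 := ht.add_minLen_le (Nat.lt_add_one i) hi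
      have h2 := ih (by omega)
      rw [Nat.succ_mul]
      omega
  simpa [ht.2.1] using this (s + 1) le_rfl

lemma IsKnots.le_mul_maxLen {k n s : ℕ} {t : ℕ → ℕ} (ht : IsKnots k n s t) :
    n + 1 ≤ k + (s + 1) * maxLen s t := by
  have : ∀ i ≤ s + 1, t i ≤ k + i * maxLen s t := by
    intro i hi
    induction i with
    | zero => simp [ht.1]
    | succ i ih =>
      have h1 := ht.segLen_eq (i := i) (by omega)
      have h3 := le_maxLen t (s := s) (i := i) (by omega)
      have h2 := ih (by omega)
      rw [Nat.succ_mul]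
      omega
  simpa [ht.2.1] using this (s + 1) le_rfl

lemma IsKnots.exists_segment {k n s : ℕ} {t : ℕ → ℕ} (ht : IsKnots k n s t) {j : ℕ} (hj : k ≤ j)
    (hjn : j ≤ n) : ∃ i ≤ s, t i ≤ j ∧ j < t (i + 1) := by
  by_contra! hne
  have : ∀ i ≤ s + 1, t i ≤ j := by
    intro i hi
    induction i with
    | zero => rw [ht.1]; exact hj
    | succ i ih => exact hne i (by omega) (ih (by omega))
  have := this (s + 1) le_rfl
  rw [ht.2.1] at this
  omega

/-- The rows that involve observations on both sides of some knot. -/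
def NearKnot (k s : ℕ) (t : ℕ → ℕ) (j : ℕ) : Prop := ∃ i ∈ Finset.Icc 1 s, t i ≤ j ∧ j < t i + k

lemma NearKnot.of_mem_activeSet {k s : ℕ} (hk : 1 ≤ k) {t : ℕ → ℕ} {j : ℕ}
    (hj : j ∈ activeSet s t) : NearKnot k s t j := by
  obtain ⟨i, hi, rfl⟩ := Finset.mem_image.1 hj
  exact ⟨i, hi, le_rfl, by omega⟩

lemma sum_sq_le_of_support {n : ℕ} {F : ℤ → ℝ} {A B : ℕ} (hAB : A ≤ B) {M : ℝ}
    (hM : ∀ y : ℤ, A ≤ y → y < B → |F y| ≤ M) (h0 : ∀ y : ℤ, ¬ (A ≤ y ∧ y < B) → F y = 0) :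
    ∑ x : Finset.Icc 1 n, F (x : ℕ) ^ 2 ≤ ((B : ℝ) - A) * M ^ 2 := by
  rw [Finset.sum_coe_sort (Finset.Icc 1 n) (fun x => F (x : ℕ) ^ 2)]
  calc ∑ x ∈ Finset.Icc 1 n, F (x : ℕ) ^ 2
      ≤ ∑ x ∈ (Finset.Icc 1 n).filter (fun x => x ∈ Finset.Ico A B), F (x : ℕ) ^ 2 := by
        rw [Finset.sum_filter]
        refine Finset.sum_le_sum fun x _ => ?_
        split_ifs with h
        · rfl
        · rw [h0 x (by rw [Finset.mem_Ico] at h; omega)]; simp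
    _ ≤ ∑ x ∈ Finset.Ico A B, F (x : ℕ) ^ 2 :=
        Finset.sum_le_sum_of_subset_of_nonneg (fun x hx => (Finset.mem_filter.1 hx).2)
          fun _ _ _ => sq_nonneg _
    _ ≤ ∑ _x ∈ Finset.Ico A B, M ^ 2 := by
        refine Finset.sum_le_sum fun x hx => ?_
        rw [Finset.mem_Ico] at hx
        rw [← sq_abs]
        exact pow_le_pow_left₀ (abs_nonneg _) (hM x (by omega) (by omega)) 2
    _ = ((B : ℝ) - A) * M ^ 2 := by
        rw [Finset.sum_const, Nat.card_Ico, nsmul_eq_mul, Nat.cast_sub hAB]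

lemma mul_pow_sq_eq {k : ℕ} (hk : 1 ≤ k) (x : ℝ) : x * (x ^ (k - 1)) ^ 2 = x ^ (2 * k - 1) := by
  obtain ⟨p, rfl⟩ : ∃ p, k = p + 1 := ⟨k - 1, by omega⟩
  rw [show 2 * (p + 1) - 1 = 2 * p + 1 by omega, Nat.add_sub_cancel]
  ring

lemma abs_greenKernel_le {k : ℕ} (hk : 1 ≤ k) {y : ℤ} {M : ℝ} (hM : (y : ℝ) + 1 ≤ M)
    (hM0 : 0 ≤ M) : |greenKernel k y| ≤ M ^ (k - 1) := by
  obtain ⟨p, rfl⟩ : ∃ p, k = p + 1 := ⟨k - 1, by omega⟩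
  rw [abs_of_nonneg (greenKernel_nonneg _ _), Nat.add_sub_cancel]
  rcases lt_or_ge y 0 with hy | hy
  · rw [greenKernel_of_neg _ hy]; positivity
  · have hy' : (0 : ℝ) ≤ y := by exact_mod_cast hy
    exact (greenKernel_succ_le p (by omega)).trans (pow_le_pow_left₀ (by linarith) hM p)

/-- Truncating the Green kernel at `T` spoils only rows `T, …, T + k - 1`. What is left has length
`T - j` and height at most `(T - j)^(k-1)`. -/
lemma exists_green_right {k n : ℕ} (hk : 1 ≤ k) {T j : ℕ} (hj : j < T) :
    ∃ ψ : Vec n, (∀ j' : Rows k n, ((j' : ℕ) < T ∨ T + k ≤ j') →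
      (diffOp k n).mulVec ψ j' = if (j' : ℕ) = j then 1 else 0) ∧
      ∑ x, ψ x ^ 2 ≤ ((T : ℝ) - j) ^ (2 * k - 1) := by
  let F : ℤ → ℝ := fun y => if y < T then greenKernel k (y + (-j : ℤ)) else 0
  refine ⟨fun x => F (x : ℕ), fun j' hj' => ?_, ?_⟩
  · rw [diffOp_mulVec_eq_fwdDiff _ F (fun _ => rfl)]
    have hj'k := (Finset.mem_Icc.1 j'.2).1
    rcases hj' with h | h
    · rw [fwdDiff_iter_congr (G := fun y => greenKernel k (y + (-j : ℤ))), fwdDiff_iter_comp_add,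
        fwdDiff_iter_greenKernel]
      · congr 1
        rw [eq_iff_iff]
        omega
      · intro r hr
        rw [Finset.mem_range] at hr
        exact if_pos (by omega)
    · rw [fwdDiff_iter_eq_zero, if_neg (by omega)]
      intro r hr
      exact if_neg (by omega)
  · rw [← mul_pow_sq_eq hk]
    have hjT : (j : ℝ) ≤ T := by exact_mod_cast hj.le
    refine sum_sq_le_of_support (F := F) hj.le (fun y hy1 hy2 => ?_) (fun y hy => ?_)
    · simp only [F]
      rw [if_pos hy2]
      refine abs_greenKernel_le hk ?_ (by linarith)
      have : ((y + 1 : ℤ) : ℝ) ≤ ((T : ℤ) : ℝ) := by exact_mod_cast (by omega : y + 1 ≤ T)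
      push_cast at this ⊢
      linarith
    · simp only [F]
      split_ifs with h
      · exact greenKernel_of_neg _ (by omega)
      · rfl

/-- Mirror image of `exists_green_right`, using the reflected, anticausal kernel. -/
lemma exists_green_left {k n : ℕ} (hk : 1 ≤ k) {T j : ℕ} (hj : T + k ≤ j) :
    ∃ ψ : Vec n, (∀ j' : Rows k n, ((j' : ℕ) < T ∨ T + k ≤ j') →
      (diffOp k n).mulVec ψ j' = if (j' : ℕ) = j then 1 else 0) ∧
      ∑ x, ψ x ^ 2 ≤ ((j : ℝ) - T) ^ (2 * k - 1) := by
  let F : ℤ → ℝ := fun y => if T ≤ y then (-1) ^ k * greenKernel k ((j - k : ℤ) - y) else 0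
  refine ⟨fun x => F (x : ℕ), fun j' hj' => ?_, ?_⟩
  · rw [diffOp_mulVec_eq_fwdDiff _ F (fun _ => rfl)]
    have hj'k := (Finset.mem_Icc.1 j'.2).1
    rcases hj' with h | h
    · rw [fwdDiff_iter_eq_zero, if_neg (by omega)]
      intro r hr
      rw [Finset.mem_range] at hr
      exact if_neg (by omega)
    · rw [fwdDiff_iter_congr
        (G := ((-1 : ℝ) ^ k) • fun y => greenKernel k ((j - k : ℤ) - y)), fwdDiff_iter_const_smul,
        Pi.smul_apply, fwdDiff_iter_reflect, fwdDiff_iter_greenKernel, smul_eq_mul, ← mul_assoc,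
        ← mul_pow]
      · simp only [mul_neg, mul_one, neg_neg, one_pow, one_mul]
        congr 1
        rw [eq_iff_iff]
        omega
      · intro r hr
        exact if_pos (by omega)
  · rw [← mul_pow_sq_eq hk]
    have hjT : (T : ℝ) ≤ j := by exact_mod_cast (by omega : T ≤ j)
    refine sum_sq_le_of_support (F := F) (by omega) (fun y hy1 hy2 => ?_) (fun y hy => ?_)
    · simp only [F]
      rw [if_pos hy1, abs_mul, abs_pow, abs_neg, abs_one, one_pow, one_mul]
      refine abs_greenKernel_le hk ?_ (by linarith)
      have h1 : ((T : ℤ) : ℝ) ≤ (y : ℝ) := by exact_mod_cast hy1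
      have h2 : (1 : ℝ) ≤ k := by exact_mod_cast hk
      push_cast at h1 ⊢
      linarith
    · simp only [F]
      split_ifs with h
      · rw [greenKernel_of_neg _ (by omega), mul_zero]
      · rfl

/-- Localised fundamental solutions of `Δ(k)` away from the knots. -/
lemma IsKnots.exists_green {k n s : ℕ} {t : ℕ → ℕ} (ht : IsKnots k n s t) (hk : 1 ≤ k)
    (j : Rows k n) (hj : ¬ NearKnot k s t j) :
    ∃ ψ : Vec n, (∀ j' : Rows k n, ¬ NearKnot k s t j' →
      (diffOp k n).mulVec ψ j' = if (j' : ℕ) = j then 1 else 0) ∧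
      (∀ i ∈ Finset.Icc 1 s, ∑ x, ψ x ^ 2 ≤ |((j : ℕ) : ℝ) - t i| ^ (2 * k - 1)) ∧
      ∑ x, ψ x ^ 2 ≤ (maxLen s t : ℝ) ^ (2 * k - 1) := by
  obtain ⟨hjk, hjn⟩ := Finset.mem_Icc.1 j.2
  obtain ⟨i, his, hi1, hi2⟩ := ht.exists_segment (by omega : k ≤ (j : ℕ)) hjn
  have hlen := ht.segLen_eq his
  have hmax := le_maxLen t his
  have hsep : ∀ i' ∈ Finset.Icc 1 s, ∀ j' : Rows k n, ¬ NearKnot k s t j' →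
      ((j' : ℕ) < t i' ∨ t i' + k ≤ j') := by
    intro i' hi' j' hj'
    by_contra! h
    exact hj' ⟨i', hi', h.1, h.2⟩
  have hright : ∀ j' : Rows k n, ¬ NearKnot k s t j' →
      ((j' : ℕ) < t (i + 1) ∨ t (i + 1) + k ≤ j') := by
    intro j' hj'
    rcases his.lt_or_eq with h | rfl
    · exact hsep (i + 1) (Finset.mem_Icc.2 ⟨by omega, h⟩) j' hj'
    · have := (Finset.mem_Icc.1 j'.2).2
      left
      rw [ht.2.1]
      omega
  have hmax1 : ((t (i + 1) : ℝ) - (j : ℕ)) ≤ maxLen s t := by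
    have : (t (i + 1) : ℝ) ≤ maxLen s t + (j : ℕ) := by exact_mod_cast (by omega)
    linarith
  have h10 : (0 : ℝ) ≤ (t (i + 1) : ℝ) - (j : ℕ) := by
    have : ((j : ℕ) : ℝ) ≤ t (i + 1) := by exact_mod_cast hi2.le
    linarith
  have h20 : (0 : ℝ) ≤ ((j : ℕ) : ℝ) - t i := by
    have : (t i : ℝ) ≤ (j : ℕ) := by exact_mod_cast hi1
    linarith
  -- Truncate at the nearer end of the segment, except that the first segment always uses its right
  -- end: truncating at `t 0 = k` could spoil rows that are not near an interior knot. Truncating at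
  -- `n + 1` spoils no row.
  by_cases hleft : 1 ≤ i ∧ (j : ℕ) - t i ≤ t (i + 1) - j
  · have hi' : i ∈ Finset.Icc 1 s := Finset.mem_Icc.2 ⟨hleft.1, his⟩
    have hd : ((j : ℕ) : ℝ) - t i ≤ (t (i + 1) : ℝ) - (j : ℕ) := by
      have : ((j : ℕ) : ℝ) + (j : ℕ) ≤ (t (i + 1) : ℝ) + t i := by
        exact_mod_cast (by omega : (j : ℕ) + j ≤ t (i + 1) + t i)
      linarith
    obtain ⟨ψ, hψ1, hψ2⟩ := exists_green_left (n := n) hk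
      ((hsep i hi' j hj).resolve_left (by omega))
    refine ⟨ψ, fun j' hj' => hψ1 j' (hsep i hi' j' hj'), fun i' hi'' => hψ2.trans ?_,
      hψ2.trans (pow_le_pow_left₀ h20 (hd.trans hmax1) _)⟩
    refine pow_le_pow_left₀ h20 ?_ _
    rw [Finset.mem_Icc] at hi''
    rcases le_or_gt i' i with h | h
    · have : (t i' : ℝ) ≤ t i := by exact_mod_cast ht.mono h (by omega)
      exact le_trans (by linarith) (le_abs_self _)
    · have : (t (i + 1) : ℝ) ≤ t i' := by exact_mod_cast ht.mono h (by omega)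
      exact le_trans (by linarith) (neg_le_abs _)
  · obtain ⟨ψ, hψ1, hψ2⟩ := exists_green_right (n := n) hk hi2
    refine ⟨ψ, fun j' hj' => hψ1 j' (hright j' hj'), fun i' hi'' => hψ2.trans ?_,
      hψ2.trans (pow_le_pow_left₀ h10 hmax1 _)⟩
    refine pow_le_pow_left₀ h10 ?_ _
    rw [Finset.mem_Icc] at hi''
    rcases le_or_gt i' i with h | h
    · have h1 : (t i' : ℝ) ≤ t i := by exact_mod_cast ht.mono h (by omega)
      have h2 : (t (i + 1) : ℝ) + t i ≤ ((j : ℕ) : ℝ) + (j : ℕ) := by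
        exact_mod_cast (by omega : t (i + 1) + t i ≤ (j : ℕ) + j)
      exact le_trans (by linarith) (le_abs_self _)
    · have : (t (i + 1) : ℝ) ≤ t i' := by exact_mod_cast ht.mono h (by omega)
      exact le_trans (by linarith) (neg_le_abs _)

/-- `Δ(k) h = 0` is a recursion with leading coefficient one, determined by the first `k` values. -/
lemma eq_zero_of_diffOp_mulVec_eq_zero {k n : ℕ} {h : Vec n} (hD : (diffOp k n).mulVec h = 0)
    (h0 : ∀ x : Finset.Icc 1 n, (x : ℕ) ≤ k → h x = 0) : h = 0 := by
  let F : ℤ → ℝ := fun y => if hy : y.toNat ∈ Finset.Icc 1 n then h ⟨y.toNat, hy⟩ else 0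
  have hF : ∀ x : Finset.Icc 1 n, F (x : ℕ) = h x := fun x => by
    have hx : ((x : ℕ) : ℤ).toNat ∈ Finset.Icc 1 n := by simp
    simp only [F]
    rw [dif_pos hx]
    simp
  have key : ∀ m : ℕ, ∀ hm : m ∈ Finset.Icc 1 n, F m = 0 := by
    intro m
    induction m using Nat.strong_induction_on with
    | _ m ih =>
      intro hm
      rcases le_or_gt m k with hmk | hmk
      · exact (hF ⟨m, hm⟩).trans (h0 _ hmk)
      · rw [Finset.mem_Icc] at hm
        have h1 := congrFun hD ⟨m, Finset.mem_Icc.2 ⟨hmk, hm.2⟩⟩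
        rw [diffOp_mulVec_eq_fwdDiff h F hF, fwdDiff_iter_eq_sum_shift,
          Finset.sum_range_succ, Finset.sum_eq_zero] at h1
        · simpa using h1
        · intro r hr
          rw [Finset.mem_range] at hr
          have h2 := ih (m - k + r) (by omega) (by rw [Finset.mem_Icc]; omega)
          have h3 : ((m : ℤ) - k + r • 1) = ((m - k + r : ℕ) : ℤ) := by
            rw [nsmul_one]
            push_cast [hmk.le]
            rfl
          rw [h3, h2, smul_zero]
  ext x
  rw [← hF]
  exact key x x.2


/-! ### The interpolating vector and the deterministic inequality. -/

lemma IsKnots.minLen_le_dist {k n s : ℕ} {t : ℕ → ℕ} (ht : IsKnots k n s t) {i i' : ℕ}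
    (hi : i ≤ s + 1) (hi' : i' ≤ s + 1) (hne : i ≠ i') :
    (minLen s t : ℝ) ≤ |(t i : ℝ) - t i'| := by
  rcases lt_or_gt_of_ne hne with h | h
  · have : (t i : ℝ) + minLen s t ≤ t i' := by exact_mod_cast ht.add_minLen_le h hi'
    exact le_trans (by linarith) (neg_le_abs _)
  · have : (t i' : ℝ) + minLen s t ≤ t i := by exact_mod_cast ht.add_minLen_le h hi
    exact le_trans (by linarith) (le_abs_self _)

/-- A signed superposition of translates of the bump `φ` to the interior knots. -/
noncomputable def interpolant (s : ℕ) (t : ℕ → ℕ) (σ : ℕ → ℝ) (φ : ℤ → ℝ) (y : ℤ) : ℝ :=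
  ∑ i ∈ Finset.Icc 1 s, σ i * φ (y - t i)

lemma interpolant_eq {k n s : ℕ} {t : ℕ → ℕ} (ht : IsKnots k n s t) (σ : ℕ → ℝ) {φ : ℤ → ℝ}
    {b : ℝ} (hφ : ∀ y : ℤ, b ≤ |(y : ℝ)| → φ y = 0) (hb : 2 * b ≤ minLen s t) {i : ℕ}
    (hi : i ∈ Finset.Icc 1 s) {y : ℤ} (hy : |(y : ℝ) - t i| < b) :
    interpolant s t σ φ y = σ i * φ (y - t i) := by
  refine Finset.sum_eq_single_of_mem i hi fun i' hi' hne => ?_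
  rw [Finset.mem_Icc] at hi hi'
  rw [hφ, mul_zero]
  have h1 := ht.minLen_le_dist (i := i) (i' := i') (by omega) (by omega) hne.symm
  have h2 := abs_sub_le (t i : ℝ) y (t i')
  rw [abs_sub_comm] at hy
  push_cast
  linarith

lemma interpolant_eq_zero {s : ℕ} {t : ℕ → ℕ} (σ : ℕ → ℝ) {φ : ℤ → ℝ}
    {b : ℝ} (hφ : ∀ y : ℤ, b ≤ |(y : ℝ)| → φ y = 0) {y : ℤ}
    (hy : ∀ i ∈ Finset.Icc 1 s, b ≤ |(y : ℝ) - t i|) : interpolant s t σ φ y = 0 := by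
  refine Finset.sum_eq_zero fun i hi => ?_
  rw [hφ, mul_zero]
  simpa using hy i hi

lemma sum_sq_eq_of_mul_eq_zero {ι : Type*} (S : Finset ι) (a : ι → ℝ)
    (h : ∀ i ∈ S, ∀ j ∈ S, i ≠ j → a i * a j = 0) : (∑ i ∈ S, a i) ^ 2 = ∑ i ∈ S, a i ^ 2 := by
  classical
  rw [sq, Finset.sum_mul_sum]
  refine Finset.sum_congr rfl fun i hi => ?_
  rw [Finset.sum_eq_single_of_mem i hi fun j hj hne => h i hi j hj hne.symm, sq]

/-- Taking `k`-th differences widens supports by `k`. With `2 b + k ≤ minLen s t` they remain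
disjoint, so the energies of the bumps simply add. -/
lemma sum_sq_fwdDiff_interpolant_le {k n s : ℕ} {t : ℕ → ℕ} (ht : IsKnots k n s t) {σ : ℕ → ℝ}
    (hσ : ∀ i, |σ i| ≤ 1) {φ : ℤ → ℝ} {b E : ℝ} (hφ : ∀ y : ℤ, b ≤ |(y : ℝ)| → φ y = 0)
    (hb : 2 * b + k ≤ minLen s t)
    (hE : ∀ Y : Finset ℤ, ∑ y ∈ Y, ((fwdDiff (1 : ℤ))^[k] φ y) ^ 2 ≤ E) (Y : Finset ℤ) :
    ∑ y ∈ Y, ((fwdDiff (1 : ℤ))^[k] (interpolant s t σ φ) y) ^ 2 ≤ s * E := by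
  have hsum : ∀ y : ℤ, (fwdDiff (1 : ℤ))^[k] (interpolant s t σ φ) y =
      ∑ i ∈ Finset.Icc 1 s, σ i * (fwdDiff (1 : ℤ))^[k] φ (y - t i) := by
    intro y
    have h1 : interpolant s t σ φ = ∑ i ∈ Finset.Icc 1 s, σ i • fun y : ℤ => φ (y + (-t i : ℤ)) := by
      ext y; simp [interpolant, sub_eq_add_neg]
    rw [h1, fwdDiff_iter_finsetSum, Finset.sum_apply]
    refine Finset.sum_congr rfl fun i _ => ?_
    rw [fwdDiff_iter_const_smul, Pi.smul_apply, fwdDiff_iter_comp_add, smul_eq_mul, sub_eq_add_neg]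
  have hsupp : ∀ y : ℤ, (fwdDiff (1 : ℤ))^[k] φ y ≠ 0 → -b - k < y ∧ (y : ℝ) < b := by
    intro y hy
    by_contra hne
    refine hy (fwdDiff_iter_eq_zero fun r hr => hφ _ ?_)
    have hr' : (r : ℝ) ≤ k := by
      exact_mod_cast Nat.lt_succ_iff.1 (Finset.mem_range.1 hr)
    have hr0 : (0 : ℝ) ≤ r := by positivity
    push_cast
    rw [not_and_or, not_lt, not_lt] at hne
    rcases hne with h | h
    · exact le_trans (by linarith) (neg_le_abs _)
    · exact le_trans (by linarith) (le_abs_self _)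
  have hprod : ∀ y : ℤ, ∀ i ∈ Finset.Icc 1 s, ∀ j ∈ Finset.Icc 1 s, i ≠ j →
      (σ i * (fwdDiff (1 : ℤ))^[k] φ (y - t i)) * (σ j * (fwdDiff (1 : ℤ))^[k] φ (y - t j)) = 0 := by
    intro y i hi j hj hne
    rw [Finset.mem_Icc] at hi hj
    by_contra h
    have h1 := hsupp _ (right_ne_zero_of_mul (left_ne_zero_of_mul h))
    have h2 := hsupp _ (right_ne_zero_of_mul (right_ne_zero_of_mul h))
    have h3 := ht.minLen_le_dist (i := i) (i' := j) (by omega) (by omega) hne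
    push_cast at h1 h2
    have h4 : |(t i : ℝ) - t j| < 2 * b + k := abs_lt.2 ⟨by linarith, by linarith⟩
    linarith
  calc _ = ∑ y ∈ Y, ∑ i ∈ Finset.Icc 1 s, (σ i * (fwdDiff (1 : ℤ))^[k] φ (y - t i)) ^ 2 :=
        Finset.sum_congr rfl fun y _ => by rw [hsum, sum_sq_eq_of_mul_eq_zero _ _ (hprod y)]
    _ ≤ ∑ y ∈ Y, ∑ i ∈ Finset.Icc 1 s, ((fwdDiff (1 : ℤ))^[k] φ (y - t i)) ^ 2 := by
        refine Finset.sum_le_sum fun y _ => Finset.sum_le_sum fun i _ => ?_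
        rw [mul_pow, ← sq_abs (σ i)]
        exact mul_le_of_le_one_left (sq_nonneg _) (pow_le_one₀ (abs_nonneg _) (hσ i))
    _ = ∑ i ∈ Finset.Icc 1 s, ∑ y ∈ Y, ((fwdDiff (1 : ℤ))^[k] φ (y - t i)) ^ 2 :=
        Finset.sum_comm
    _ ≤ ∑ _i ∈ Finset.Icc 1 s, E := by
        refine Finset.sum_le_sum fun i _ => ?_
        refine le_trans (le_of_eq ?_) (hE (Y.image fun y => y - t i))
        rw [Finset.sum_image fun a _ b _ h => by simpa using h]
    _ = s * E := by simp

/-- The subgradient inequality for `|·|` at `a`. -/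
lemma abs_sub_abs_add_le (a x : ℝ) : |a| - |a + x| ≤ -(SignType.sign a * x) := by
  rcases lt_trichotomy a 0 with h | rfl | h
  · rw [sign_neg h, abs_of_neg h]
    have := neg_le_abs (a + x)
    simp only [SignType.coe_neg_one]
    linarith
  · simp
  · rw [sign_pos h, abs_of_pos h]
    have := le_abs_self (a + x)
    simp only [SignType.coe_one]
    linarith

/-- The deterministic part of the oracle inequality. -/
theorem IsKnots.exists_oracle_forms {k n s : ℕ} {t : ℕ → ℕ} (ht : IsKnots k n s t) (hk : 1 ≤ k)
    {φ : ℤ → ℝ} {b c E κ : ℝ} (hφ1 : φ 0 = 1) (hφ0 : ∀ y, 0 ≤ φ y)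
    (hφ : ∀ y : ℤ, b ≤ |(y : ℝ)| → φ y = 0)
    (hφc : ∀ y : ℤ, |(y : ℝ)| ≤ b → φ y ≤ 1 - c * √((|(y : ℝ)| / b) ^ (2 * k - 1)))
    (hE : ∀ Y : Finset ℤ, ∑ y ∈ Y, ((fwdDiff (1 : ℤ))^[k] φ y) ^ 2 ≤ E)
    (hb0 : 0 < b) (hc : 0 ≤ c) (hb : 2 * b + k ≤ minLen s t) (hκ : 0 ≤ κ)
    (hκb : κ * √(b ^ (2 * k - 1)) ≤ c) (hκm : κ * √((maxLen s t : ℝ) ^ (2 * k - 1)) ≤ 1) :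
    ∃ (N : Type) (_ : Fintype N) (a : N → Vec n) (β : N → ℝ), Fintype.card N ≤ 2 * n ∧
      (∀ i, 0 ≤ β i) ∧ (∀ i, ∑ x, a i x ^ 2 ≤ β i ^ 2) ∧
      ∀ (ε f h : Vec n) (μ : ℝ), 0 ≤ μ → (∀ i, |∑ x, a i x * ε x| ≤ κ * μ * β i) →
        ∑ x, ε x * h x + μ * (∑ i, |(diffOp k n).mulVec f i| -
          ∑ i, |(diffOp k n).mulVec (f + h) i|) ≤
        2 * μ * offNorm k (activeSet s t) f +
          (√(k * (s + 1)) * (κ * μ) + μ * √(s * E)) * √(∑ x, h x ^ 2) := by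
  classical
  let J := {j : Rows k n // ¬ NearKnot k s t j}
  choose! ψ hψ1 hψ2 hψ3 using fun j => ht.exists_green hk (n := n) j
  let D : Vec n →ₗ[ℝ] (J → ℝ) := LinearMap.funLeft ℝ ℝ Subtype.val ∘ₗ (diffOp k n).mulVecLin
  have hD : ∀ v j, D v j = (diffOp k n).mulVec v j := fun v j => rfl
  -- `G` records the rows near knots and the first `k` coordinates. It is injective on `ker D`,
  -- which bounds that kernel's dimension by `k (s + 1)`.
  let G : Vec n →ₗ[ℝ] ((Fin s × Fin k) ⊕ Fin k → ℝ) := LinearMap.pi fun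
    | .inl i => if hi : t (i.1 + 1) + i.2 ∈ Finset.Icc (k + 1) n then
        LinearMap.proj (⟨_, hi⟩ : Rows k n) ∘ₗ (diffOp k n).mulVecLin else 0
    | .inr r => if hr : (r : ℕ) + 1 ∈ Finset.Icc 1 n then LinearMap.proj ⟨_, hr⟩ else 0
  have hDG : ∀ v, D v = 0 → G v = 0 → v = 0 := by
    intro v hv hv'
    refine eq_zero_of_diffOp_mulVec_eq_zero (k := k) (funext fun j => ?_) fun x hx => ?_
    · by_cases hj : NearKnot k s t j
      · obtain ⟨i, hi, h1, h2⟩ := hj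
        rw [Finset.mem_Icc] at hi
        have h3 := congrFun hv' (.inl (⟨i - 1, by omega⟩, ⟨(j : ℕ) - t i, by omega⟩))
        have h4 : t (i - 1 + 1) + ((j : ℕ) - t i) = j := by
          rw [Nat.sub_add_cancel hi.1]; omega
        have h5 : t (i - 1 + 1) + ((j : ℕ) - t i) ∈ Finset.Icc (k + 1) n := by rw [h4]; exact j.2
        simp only [G, LinearMap.pi_apply, dif_pos h5] at h3
        have h6 : (⟨_, h5⟩ : Rows k n) = j := Subtype.ext h4
        rw [h6] at h3
        exact h3
      · exact congrFun hv ⟨j, hj⟩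
    · have hx' := Finset.mem_Icc.1 x.2
      have h3 := congrFun hv' (.inr ⟨(x : ℕ) - 1, by omega⟩)
      have h4 : (x : ℕ) - 1 + 1 = x := by omega
      have h5 : (x : ℕ) - 1 + 1 ∈ Finset.Icc 1 n := by rw [h4]; exact x.2
      simp only [G, LinearMap.pi_apply, dif_pos h5] at h3
      have h6 : (⟨_, h5⟩ : Finset.Icc 1 n) = x := Subtype.ext h4
      rw [h6] at h3
      exact h3
  obtain ⟨d, a, a', -, hdn, ha, ha', hmain⟩ := exists_noise_forms D G hDG (fun j : J => ψ j) (by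
    intro j
    ext j'
    rw [hD, hψ1 j.1 j.2 j'.1 j'.2, Pi.single_apply]
    congr 1
    rw [eq_iff_iff, Subtype.ext_iff, Subtype.ext_iff])
  refine ⟨Fin d ⊕ J, inferInstance, Sum.elim a a', Sum.elim (fun _ => 1)
    (fun j => √(∑ x, ψ j x ^ 2)), ?_, ?_, ?_, ?_⟩
  · have h1 : Fintype.card J ≤ n := by
      refine (Fintype.card_subtype_le _).trans ?_
      simp
    have h2 : d ≤ n := by simpa using hdn
    rw [Fintype.card_sum, Fintype.card_fin]
    omega
  · rintro (i | j)
    · exact zero_le_one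
    · exact Real.sqrt_nonneg _
  · rintro (i | j)
    · simpa using (ha i).le
    · simp only [Sum.elim_inr]
      rw [Real.sq_sqrt (Finset.sum_nonneg fun _ _ => sq_nonneg _)]
      exact ha' j
  · intro ε f h μ hμ hnoise
    have hb' : 2 * b ≤ minLen s t := by
      have : (0 : ℝ) ≤ k := by positivity
      linarith
    let v := (diffOp k n).mulVec f
    let w := (diffOp k n).mulVec h
    let σ : ℕ → ℝ := fun i => if hi : t i ∈ Finset.Icc (k + 1) n then
      ((SignType.sign (v ⟨t i, hi⟩) : SignType) : ℝ) else 0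
    have hσ : ∀ i, |σ i| ≤ 1 := by
      intro i
      simp only [σ]
      split_ifs with hi
      · rcases SignType.sign (v ⟨t i, hi⟩) <;> simp
      · simp
    let Q := interpolant s t σ φ
    have hQ : ∀ y : ℤ, Q y = 0 ∨ ∃ i ∈ Finset.Icc 1 s, |(y : ℝ) - t i| < b ∧
        |Q y| ≤ 1 - c * √((|(y : ℝ) - t i| / b) ^ (2 * k - 1)) := by
      intro y
      by_cases hy : ∀ i ∈ Finset.Icc 1 s, b ≤ |(y : ℝ) - t i|
      · exact Or.inl (interpolant_eq_zero σ hφ hy)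
      · push Not at hy
        obtain ⟨i, hi, hyi⟩ := hy
        refine Or.inr ⟨i, hi, hyi, ?_⟩
        simp only [Q]
        rw [interpolant_eq ht σ hφ hb' hi hyi, abs_mul, abs_of_nonneg (hφ0 _)]
        have h1 := hφc (y - t i) (by push_cast; exact hyi.le)
        push_cast at h1
        exact (mul_le_of_le_one_left (hφ0 _) (hσ i)).trans h1
    have hQ1 : ∀ y : ℤ, |Q y| ≤ 1 := by
      intro y
      rcases hQ y with h0 | ⟨i, -, -, h1⟩
      · rw [h0]; simp
      · exact h1.trans (sub_le_self _ (by positivity))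
    -- Key comparison: the slack `1 - |Q|` pays for the noise weight. Inside a bump both scale as
    -- distance to the power `k - 1/2` and `hκb` decides; outside, the slack is one and `hκm`
    -- suffices.
    have hQw : ∀ j : Rows k n, ¬ NearKnot k s t j →
        κ * √(∑ x, ψ j x ^ 2) ≤ 1 - |Q (j : ℕ)| := by
      intro j hj
      rcases hQ (j : ℕ) with h0 | ⟨i, hi, h1, h2⟩
      · rw [h0, abs_zero, sub_zero]
        exact (mul_le_mul_of_nonneg_left (Real.sqrt_le_sqrt (hψ3 j hj)) hκ).trans hκm
      · rw [Int.cast_natCast] at h1 h2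
        rw [div_pow, Real.sqrt_div (by positivity)] at h2
        have h3 : κ * √(|((j : ℕ) : ℝ) - t i| ^ (2 * k - 1)) ≤
            c * (√(|((j : ℕ) : ℝ) - t i| ^ (2 * k - 1)) / √(b ^ (2 * k - 1))) := by
          rw [← mul_div_assoc, le_div_iff₀ (by positivity)]
          nlinarith [Real.sqrt_nonneg (|((j : ℕ) : ℝ) - t i| ^ (2 * k - 1))]
        have h4 := mul_le_mul_of_nonneg_left (Real.sqrt_le_sqrt (hψ2 j hj i hi)) hκ
        linarith
    have hQσ : ∀ j : Rows k n, (j : ℕ) ∈ activeSet s t →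
        Q (j : ℕ) = ((SignType.sign (v j) : SignType) : ℝ) := by
      intro j hj
      obtain ⟨i, hi, hij⟩ := Finset.mem_image.1 hj
      have h1 : t i ∈ Finset.Icc (k + 1) n := by rw [hij]; exact j.2
      have h2 : (⟨t i, h1⟩ : Rows k n) = j := Subtype.ext hij
      simp only [Q]
      rw [interpolant_eq ht σ hφ hb' hi (by rw [← hij]; simpa using hb0), ← hij]
      simp only [σ, dif_pos h1, sub_self, hφ1, mul_one, h2]
    -- Active rows use the subgradient inequality; inactive rows near a knot need only `|Q| ≤ 1`, as
    -- they carry no noise weight; the other rows use `hQw`.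
    have hrow : ∀ j : Rows k n, |v j| - |v j + w j| +
        (if NearKnot k s t j then 0 else κ * √(∑ x, ψ j x ^ 2) * |w j|) ≤
        2 * (if (j : ℕ) ∈ activeSet s t then 0 else |v j|) - Q (j : ℕ) * w j := by
      intro j
      have h3 : |w j| - |v j| ≤ |v j + w j| := by
        have := abs_sub (v j + w j) (v j)
        rw [add_sub_cancel_left] at this
        linarith
      have h5 : Q (j : ℕ) * w j ≤ |Q (j : ℕ)| * |w j| := (le_abs_self _).trans (abs_mul _ _).le
      by_cases hS : (j : ℕ) ∈ activeSet s t
      · rw [if_pos (NearKnot.of_mem_activeSet hk hS), if_pos hS, hQσ j hS]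
        have := abs_sub_abs_add_le (v j) (w j)
        linarith
      · rw [if_neg hS]
        split_ifs with hN
        · have h4 : |Q (j : ℕ)| * |w j| ≤ |w j| :=
            mul_le_of_le_one_left (abs_nonneg _) (hQ1 _)
          linarith
        · have h4 := mul_le_mul_of_nonneg_right (hQw j hN) (abs_nonneg (w j))
          linarith
    have hsumrow := Finset.sum_le_sum fun j (_ : j ∈ Finset.univ) => hrow j
    have hadj : -∑ j : Rows k n, Q (j : ℕ) * w j ≤ √(s * E) * √(∑ x, h x ^ 2) := by
      have h1 : ∑ j : Rows k n, Q (j : ℕ) * w j =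
          ∑ x, Matrix.vecMul (fun j : Rows k n => Q (j : ℕ)) (diffOp k n) x * h x :=
        Matrix.dotProduct_mulVec _ _ _
      rw [h1, ← Finset.sum_neg_distrib]
      simp_rw [← neg_mul]
      refine (Real.sum_mul_le_sqrt_mul_sqrt _ _ _).trans ?_
      gcongr
      -- The extreme knots are at least `minLen s t > b` away from `k` and `n + 1`, so no bump
      -- leaves the row range.
      have hQ0 : ∀ j : ℕ, j ∉ Finset.Icc (k + 1) n → Q j = 0 := by
        intro j hj
        refine interpolant_eq_zero σ hφ fun i hi => ?_
        rw [Finset.mem_Icc] at hi hj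
        have h2 : t 0 + minLen s t ≤ t i := ht.add_minLen_le (by omega) (by omega)
        have h3 : t i + minLen s t ≤ t (s + 1) := ht.add_minLen_le (by omega) le_rfl
        rw [ht.1] at h2
        rw [ht.2.1] at h3
        have hk0 : (1 : ℝ) ≤ k := by exact_mod_cast hk
        rw [Int.cast_natCast]
        rcases le_or_gt j k with h4 | h4
        · have h5 : (j : ℝ) + minLen s t ≤ t i := by exact_mod_cast (by omega)
          exact le_trans (by linarith) (neg_le_abs _)
        · have h5 : (t i : ℝ) + minLen s t ≤ j := by exact_mod_cast (by omega)
          exact le_trans (by linarith) (le_abs_self _)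
      calc _ = ∑ x : Finset.Icc 1 n, ((fwdDiff (1 : ℤ))^[k] Q (x : ℕ)) ^ 2 := by
            refine Finset.sum_congr rfl fun x _ => ?_
            rw [diffOp_vecMul_eq_fwdDiff _ Q (fun _ => rfl) hQ0, neg_sq, mul_pow, ← pow_mul,
              mul_comm k 2, pow_mul]
            simp
        _ = ∑ x ∈ Finset.Icc 1 n, ((fwdDiff (1 : ℤ))^[k] Q (x : ℕ)) ^ 2 :=
            Finset.sum_coe_sort (Finset.Icc 1 n)
              (fun x => ((fwdDiff (1 : ℤ))^[k] Q (x : ℕ)) ^ 2)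
        _ = ∑ y ∈ (Finset.Icc 1 n).image (fun x : ℕ => (x : ℤ)),
              ((fwdDiff (1 : ℤ))^[k] Q y) ^ 2 := by
            rw [Finset.sum_image fun a _ b _ h => by simpa using h]
        _ ≤ _ := sum_sq_fwdDiff_interpolant_le ht hσ hφ hb hE _
    have hnoise' := hmain ε h (κ * μ) (fun j => κ * μ * √(∑ x, ψ j x ^ 2)) (by positivity)
      (fun i => by simpa using hnoise (.inl i)) (fun j => hnoise (.inr j))
    have hJ : ∑ j : J, κ * μ * √(∑ x, ψ j x ^ 2) * |D h j| =
        μ * ∑ j : Rows k n, if NearKnot k s t j then 0 else κ * √(∑ x, ψ j x ^ 2) * |w j| := by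
      simp_rw [← ite_not (NearKnot k s t _)]
      rw [← Finset.sum_filter, Finset.mul_sum,
        Finset.sum_subtype (p := fun j : Rows k n => ¬ NearKnot k s t j) _ (by simp)]
      refine Finset.sum_congr rfl fun j _ => ?_
      rw [hD]
      simp only [w]
      ring
    have hcard : (Fintype.card ((Fin s × Fin k) ⊕ Fin k) : ℝ) = k * (s + 1) := by
      simp only [Fintype.card_sum, Fintype.card_prod, Fintype.card_fin]
      push_cast
      ring
    rw [hJ, hcard] at hnoise'
    rw [Finset.sum_add_distrib, Finset.sum_sub_distrib, Finset.sum_sub_distrib,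
      ← Finset.mul_sum] at hsumrow
    have hoff : ∑ j : Rows k n, (if (j : ℕ) ∈ activeSet s t then 0 else |v j|) =
        offNorm k (activeSet s t) f := rfl
    rw [hoff] at hsumrow
    rw [Matrix.mulVec_add]
    have hfin := mul_le_mul_of_nonneg_left hsumrow hμ
    have hfin2 := mul_le_mul_of_nonneg_left hadj hμ
    simp only [Pi.add_apply]
    simp only [v, w] at hfin hfin2 hnoise'
    linarith


/-! ### Basic inequality, choice of constants and the high-probability bound. -/

/-- Compare `g` with `g + θ (f - g)`, divide by `θ` and let `θ → 0`. This first-order condition,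
rather than a direct comparison with `f`, is what yields the extra `‖g - f‖²` in the basic
inequality. -/
lemma IsEstimate.two_mul_inner_le {k n : ℕ} {lam : ℝ} (hlam : 0 ≤ lam) {y g : Vec n}
    (hg : IsEstimate k lam y g) (f : Vec n) :
    2 * (∑ x, (y x - g x) * (f x - g x)) / n ≤
      2 * lam * (∑ i, |(diffOp k n).mulVec f i| - ∑ i, |(diffOp k n).mulVec g i|) := by
  set P := (∑ x, (y x - g x) * (f x - g x)) / n
  set V := ∑ i, |(diffOp k n).mulVec f i| - ∑ i, |(diffOp k n).mulVec g i|
  have key : ∀ θ ∈ Set.Ioo (0 : ℝ) 1, 2 * P ≤ 2 * lam * V + θ * sqNorm (f - g) := by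
    rintro θ ⟨hθ0, hθ1⟩
    have h1 := hg (g + θ • (f - g))
    have h2 : sqNorm (y - (g + θ • (f - g))) =
        sqNorm (y - g) - 2 * θ * P + θ ^ 2 * sqNorm (f - g) := by
      have : ∑ x, (y - (g + θ • (f - g))) x ^ 2 = ∑ x, (y - g) x ^ 2 -
          2 * θ * ∑ x, (y x - g x) * (f x - g x) + θ ^ 2 * ∑ x, (f - g) x ^ 2 := by
        rw [Finset.mul_sum, Finset.mul_sum, ← Finset.sum_sub_distrib, ← Finset.sum_add_distrib]
        refine Finset.sum_congr rfl fun x _ => ?_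
        simp only [Pi.sub_apply, Pi.add_apply, Pi.smul_apply, smul_eq_mul]
        ring
      simp only [sqNorm, P]
      rw [this]
      ring
    have h3 : ∑ i, |(diffOp k n).mulVec (g + θ • (f - g)) i| ≤
        ∑ i, |(diffOp k n).mulVec g i| + θ * V := by
      simp only [V]
      rw [mul_sub, Finset.mul_sum, Finset.mul_sum, ← Finset.sum_sub_distrib,
        ← Finset.sum_add_distrib]
      refine Finset.sum_le_sum fun i _ => ?_
      have h4 : (diffOp k n).mulVec (g + θ • (f - g)) i =
          (1 - θ) * (diffOp k n).mulVec g i + θ * (diffOp k n).mulVec f i := by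
        rw [Matrix.mulVec_add, Matrix.mulVec_smul, Matrix.mulVec_sub]
        simp only [Pi.add_apply, Pi.smul_apply, Pi.sub_apply, smul_eq_mul]
        ring
      rw [h4]
      refine (abs_add_le _ _).trans (le_of_eq ?_)
      rw [abs_mul, abs_mul, abs_of_pos hθ0, abs_of_pos (by linarith : 0 < 1 - θ)]
      ring
    simp only [criterion] at h1
    rw [h2] at h1
    have h5 := mul_le_mul_of_nonneg_left h3 (by linarith : 0 ≤ 2 * lam)
    have h6 : θ * (2 * P) ≤ θ * (2 * lam * V + θ * sqNorm (f - g)) := by linarith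
    exact le_of_mul_le_mul_left h6 hθ0
  have hlim : Tendsto (fun θ : ℝ => 2 * lam * V + θ * sqNorm (f - g)) (𝓝[>] 0)
      (𝓝 (2 * lam * V)) := by
    have : Continuous fun θ : ℝ => 2 * lam * V + θ * sqNorm (f - g) := by fun_prop
    have h := this.tendsto 0
    rw [zero_mul, add_zero] at h
    exact h.mono_left nhdsWithin_le_nhds
  rw [mul_div_assoc]
  exact ge_of_tendsto hlim (eventually_of_mem (Ioo_mem_nhdsGT one_pos) key)

/-- The basic inequality for penalised least squares. -/
lemma IsEstimate.basic_inequality {k n : ℕ} (hn : 1 ≤ n) {lam : ℝ} (hlam : 0 ≤ lam) {y g : Vec n}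
    (hg : IsEstimate k lam y g) (f f₀ : Vec n) :
    n * sqNorm (g - f₀) + ∑ x, (g - f) x ^ 2 ≤ n * sqNorm (f - f₀) +
      2 * (∑ x, (y x - f₀ x) * (g - f) x + n * lam *
        (∑ i, |(diffOp k n).mulVec f i| - ∑ i, |(diffOp k n).mulVec g i|)) := by
  have hn0 : (0 : ℝ) < n := by exact_mod_cast hn
  have h1 := hg.two_mul_inner_le hlam f
  rw [div_le_iff₀ hn0] at h1
  have h2 : ∀ v : Vec n, n * sqNorm v = ∑ x, v x ^ 2 := fun v => by
    rw [sqNorm, mul_div_cancel₀ _ hn0.ne']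
  rw [h2, h2]
  have h3 : ∑ x, (g - f₀) x ^ 2 + ∑ x, (g - f) x ^ 2 = ∑ x, (f - f₀) x ^ 2 +
      2 * ∑ x, (y x - f₀ x) * (g - f) x + 2 * ∑ x, (y x - g x) * (f x - g x) := by
    rw [Finset.mul_sum, Finset.mul_sum, ← Finset.sum_add_distrib, ← Finset.sum_add_distrib,
      ← Finset.sum_add_distrib]
    refine Finset.sum_congr rfl fun x _ => ?_
    simp only [Pi.sub_apply]
    ring
  rw [h3]
  linarith

/-- Shows what the rate means: the bound on a Green function's norm at the average segment length `n
/ (s + 1)`, times the noise level `√(log n)`. -/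
lemma tuningRate_mul {k n s : ℕ} (hk : 1 ≤ k) (hn : 1 ≤ n) :
    n * tuningRate k n s = √(((n : ℝ) / (s + 1)) ^ (2 * k - 1)) * √(Real.log n) := by
  obtain ⟨p, rfl⟩ : ∃ p, k = p + 1 := ⟨k - 1, by omega⟩
  have hn0 : (0 : ℝ) < n := by exact_mod_cast hn
  have hs0 : (0 : ℝ) < (s : ℝ) + 1 := by positivity
  have h1 : (1 / ((s : ℝ) + 1)) ^ ((2 * ((p + 1 : ℕ) : ℝ) - 1) / 2) =
      √((1 / ((s : ℝ) + 1)) ^ (2 * p + 1)) := by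
    rw [Real.sqrt_eq_rpow, ← Real.rpow_natCast, ← Real.rpow_mul (by positivity)]
    congr 1
    push_cast
    ring
  have h2 : √((n : ℝ) ^ (2 * p + 1)) = n ^ p * √n := by
    rw [pow_succ, Real.sqrt_mul (by positivity), mul_comm 2 p, pow_mul,
      Real.sqrt_sq (by positivity)]
  rw [show 2 * (p + 1) - 1 = 2 * p + 1 by omega, tuningRate, h1, Nat.add_sub_cancel,
    div_eq_mul_one_div (n : ℝ), mul_pow, Real.sqrt_mul (by positivity), h2,
    Real.sqrt_div' _ hn0.le]
  have h3 : (n : ℝ) / √n = √n := Real.div_sqrt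
  calc _ = (n : ℝ) ^ p * √((1 / ((s : ℝ) + 1)) ^ (2 * p + 1)) * √(Real.log n) * (n / √n) := by ring
    _ = _ := by rw [h3]; ring

lemma tuningRate_pos {k n s : ℕ} (hn : 2 ≤ n) : 0 < tuningRate k n s := by
  have hn0 : (0 : ℝ) < n := by exact_mod_cast (by omega : 0 < n)
  have : 0 < Real.log n := Real.log_pos (by exact_mod_cast hn)
  unfold tuningRate
  positivity

/-- The tuning parameter `A * tuningRate`, made positive for the degenerate sample sizes. -/
noncomputable def tuning (A : ℝ) (k : ℕ) (s : ℕ → ℕ) (n : ℕ) : ℝ :=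
  if 2 ≤ n then A * tuningRate k n (s n) else 1

lemma tuning_pos {A : ℝ} (hA : 0 < A) (k : ℕ) (s : ℕ → ℕ) (n : ℕ) : 0 < tuning A k s n := by
  unfold tuning
  split_ifs with h
  · exact mul_pos hA (tuningRate_pos h)
  · exact one_pos

lemma tuning_isTheta {A : ℝ} (hA : 0 < A) (k : ℕ) (s : ℕ → ℕ) :
    tuning A k s =Θ[atTop] fun n => tuningRate k n (s n) := by
  have h1 : tuning A k s =ᶠ[atTop] fun n => A * tuningRate k n (s n) := by
    filter_upwards [eventually_ge_atTop 2] with n hn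
    exact if_pos hn
  exact h1.trans_isTheta ((isTheta_const_mul_left hA.ne').2 (isTheta_refl _ _))

/-- Oracle inequality on a high-probability event, for one balanced set of knots. -/
lemma IsKnots.oracle_event {k n s : ℕ} {t : ℕ → ℕ} (ht : IsKnots k n s t) (hk : 1 ≤ k)
    {c C K A : ℝ} (hc : 0 < c) (hC : 0 < C) (hK : 0 < K)
    (hbump : ∀ b : ℝ, 1 ≤ b → ∃ φ : ℤ → ℝ, φ 0 = 1 ∧ (∀ y, 0 ≤ φ y) ∧
      (∀ y : ℤ, b ≤ |(y : ℝ)| → φ y = 0) ∧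
      (∀ y : ℤ, |(y : ℝ)| ≤ b → φ y ≤ 1 - c * √((|(y : ℝ)| / b) ^ (2 * k - 1))) ∧
      ∀ Y : Finset ℤ, ∑ y ∈ Y, ((fwdDiff (1 : ℤ))^[k] φ y) ^ 2 ≤
        C * (1 + Real.log b) / b ^ (2 * k - 1))
    (hA : A = 2 / c + 2 * √(K ^ (2 * k - 1))) (hlen : k * (k + 2) ≤ minLen s t)
    (hbal : (maxLen s t : ℝ) ≤ K * minLen s t) (hn : 2 * k + 2 ≤ n) :
    ∃ (N : Type) (_ : Fintype N) (a : N → Vec n) (β : N → ℝ), Fintype.card N ≤ 2 * n ∧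
      (∀ i, 0 ≤ β i) ∧ (∀ i, ∑ x, a i x ^ 2 ≤ β i ^ 2) ∧ 0 < remainderRate n s ∧
      ∀ f₀ y g f : Vec n, (∀ i, |∑ x, a i x * (y x - f₀ x)| ≤ 2 * √(Real.log n) * β i) →
        IsEstimate k (A * tuningRate k n s) y g →
        sqNorm (g - f₀) ≤ sqNorm (f - f₀) +
          4 * (A * tuningRate k n s) * offNorm k (activeSet s t) f +
          (8 * k + 4 * A ^ 2 * (6 * K) ^ (2 * k - 1) * C) * remainderRate n s := by
  have hn0 : (0 : ℝ) < n := by exact_mod_cast (by omega : 0 < n)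
  have hs0 : (0 : ℝ) < (s : ℝ) + 1 := by positivity
  have hk1 : (1 : ℝ) ≤ k := by exact_mod_cast hk
  have hA0 : 0 < A := by rw [hA]; positivity
  set ℓ : ℝ := (minLen s t : ℝ) with hℓ
  set m : ℝ := (n : ℝ) / (s + 1) with hm
  -- From `k (k + 2) ≥ 3 k`. This makes `b = ℓ / 3` satisfy both `b ≥ 1` and `2 b + k ≤ ℓ`.
  have hℓ3k : 3 * (k : ℝ) ≤ ℓ := by
    have : 3 * k ≤ minLen s t := by nlinarith
    rw [hℓ]
    exact_mod_cast this
  have hℓm : ℓ ≤ m := by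
    have h1 := ht.mul_minLen_le
    have h2 : ((s : ℝ) + 1) * ℓ ≤ n := by
      rw [hℓ]
      exact_mod_cast (by omega : (s + 1) * minLen s t ≤ n)
    rw [hm, le_div_iff₀ hs0]
    linarith
  have hmL : m ≤ 2 * maxLen s t := by
    have h1 := ht.le_mul_maxLen
    have h2 : (n : ℝ) ≤ 2 * (((s : ℝ) + 1) * maxLen s t) := by
      exact_mod_cast (by omega : n ≤ 2 * ((s + 1) * maxLen s t))
    rw [hm, div_le_iff₀ hs0]
    linarith
  have hm3 : 3 ≤ m := by linarith
  have hm0 : 0 < m := by linarith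
  -- `m ≥ 3 > e`; this lets the kernel term `(s + 1) log n` be absorbed into the remainder.
  have hlogm : 1 ≤ Real.log m := by
    rw [Real.le_log_iff_exp_le hm0]
    linarith [Real.exp_one_lt_d9]
  have hlogn : 0 < Real.log n := Real.log_pos (by exact_mod_cast (by omega : 1 < n))
  have hb1 : 1 ≤ ℓ / 3 := by linarith
  set b := ℓ / 3 with hb
  obtain ⟨φ, hφ1, hφ0, hφz, hφc, hφE⟩ := hbump b hb1
  set S := √(m ^ (2 * k - 1)) with hS
  have hS0 : 0 < S := by positivity
  -- Chosen so that `κ * μ`, with `μ = n λ`, is exactly the Gaussian threshold `2 √(log n)`. The two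
  -- summands of `A` serve `hκb` and `hκm` respectively.
  set κ := 2 / (A * S) with hκ
  have hκ0 : 0 < κ := by positivity
  have hμ : n * (A * tuningRate k n s) = A * S * √(Real.log n) := by
    have := tuningRate_mul (s := s) hk (by omega : 1 ≤ n)
    rw [mul_left_comm, this]
    ring
  have hκμ : κ * (A * S * √(Real.log n)) = 2 * √(Real.log n) := by
    rw [hκ]; field_simp
  have hκb : κ * √(b ^ (2 * k - 1)) ≤ c := by
    have h1 : √(b ^ (2 * k - 1)) ≤ S :=
      Real.sqrt_le_sqrt (pow_le_pow_left₀ (by linarith) (by linarith) _)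
    have h2 : 2 / c ≤ A := by
      rw [hA]
      exact le_add_of_nonneg_right (by positivity)
    rw [div_le_iff₀ hc] at h2
    calc κ * √(b ^ (2 * k - 1)) ≤ κ * S := by gcongr
      _ = 2 / A := by rw [hκ]; field_simp
      _ ≤ c := by rw [div_le_iff₀ hA0]; linarith
  have hκm : κ * √((maxLen s t : ℝ) ^ (2 * k - 1)) ≤ 1 := by
    have h1 : √((maxLen s t : ℝ) ^ (2 * k - 1)) ≤ √(K ^ (2 * k - 1)) * S := by
      rw [hS, ← Real.sqrt_mul (by positivity), ← mul_pow]
      refine Real.sqrt_le_sqrt (pow_le_pow_left₀ (by positivity) ?_ _)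
      exact hbal.trans (by gcongr)
    have h2 : 2 * √(K ^ (2 * k - 1)) ≤ A := by
      rw [hA]
      exact le_add_of_nonneg_left (by positivity)
    calc κ * √((maxLen s t : ℝ) ^ (2 * k - 1)) ≤ κ * (√(K ^ (2 * k - 1)) * S) := by gcongr
      _ = 2 * √(K ^ (2 * k - 1)) / A := by rw [hκ]; field_simp
      _ ≤ 1 := by rw [div_le_iff₀ hA0]; linarith
  obtain ⟨N, hN, a, β, hcard, hβ, haβ, hmain⟩ := ht.exists_oracle_forms hk hφ1 hφ0 hφz hφc hφE
    (by linarith) hc.le (by rw [hb]; linarith) hκ0.le hκb hκm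
  have hrate : 0 < remainderRate n s := by
    unfold remainderRate
    have : 0 < Real.log ((n : ℝ) / (s + 1)) := by rw [← hm]; linarith
    positivity
  refine ⟨N, hN, a, β, hcard, hβ, haβ, hrate, fun f₀ y g f hev hg => ?_⟩
  set E := C * (1 + Real.log b) / b ^ (2 * k - 1) with hE
  have hlogb : 0 ≤ Real.log b := Real.log_nonneg hb1
  have hE0 : 0 ≤ E := by positivity
  have hlam0 : 0 ≤ A * tuningRate k n s := (mul_pos hA0 (tuningRate_pos (by omega))).le
  have hbasic := hg.basic_inequality (by omega) hlam0 f f₀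
  have horacle := hmain (fun x => y x - f₀ x) f (g - f) (A * S * √(Real.log n)) (by positivity)
    (fun i => by rw [hκμ]; exact hev i)
  rw [add_sub_cancel, hκμ] at horacle
  rw [hμ] at hbasic
  set X := √(∑ x, (g - f) x ^ 2)
  have hX : ∑ x, (g - f) x ^ 2 = X ^ 2 :=
    (Real.sq_sqrt (Finset.sum_nonneg fun _ _ => sq_nonneg _)).symm
  rw [hX] at hbasic
  set U := √(k * ((s : ℝ) + 1)) * (2 * √(Real.log n))
  set W := A * S * √(Real.log n) * √(s * E)
  have hU : U ^ 2 = 4 * k * (s + 1) * Real.log n := by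
    simp only [U]
    rw [mul_pow, mul_pow, Real.sq_sqrt (by positivity), Real.sq_sqrt hlogn.le]
    ring
  have hbm : m ≤ 6 * K * b := by
    rw [hb]
    linarith
  have hratio : m ^ (2 * k - 1) / b ^ (2 * k - 1) ≤ (6 * K) ^ (2 * k - 1) := by
    rw [div_le_iff₀ (by positivity), ← mul_pow]
    exact pow_le_pow_left₀ hm0.le hbm _
  have hlogbm : 1 + Real.log b ≤ 2 * Real.log m := by
    have := Real.log_le_log (by linarith) (by linarith : b ≤ m)
    linarith
  have hW : W ^ 2 ≤ 2 * A ^ 2 * (6 * K) ^ (2 * k - 1) * C * ((s + 1) * Real.log m * Real.log n) := by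
    calc W ^ 2 = A ^ 2 * C * Real.log n * (m ^ (2 * k - 1) / b ^ (2 * k - 1)) * s *
          (1 + Real.log b) := by
          simp only [W]
          rw [mul_pow, mul_pow, mul_pow, Real.sq_sqrt (by positivity : 0 ≤ m ^ (2 * k - 1)),
            Real.sq_sqrt hlogn.le, Real.sq_sqrt (by positivity : 0 ≤ s * E), hE]
          ring
      _ ≤ A ^ 2 * C * Real.log n * (6 * K) ^ (2 * k - 1) * (s + 1) * (2 * Real.log m) := by
          gcongr
          linarith
      _ = _ := by ring
  -- Completing the square: the spare `-X ^ 2` from the basic inequality absorbs the linear terms.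
  have hUW : 2 * ((U + W) * X) - X ^ 2 ≤ 2 * U ^ 2 + 2 * W ^ 2 := by
    have h1 := sq_nonneg (X - (U + W))
    have h2 := sq_nonneg (U - W)
    linarith
  have hU' : 2 * U ^ 2 ≤ 8 * k * ((s + 1) * Real.log m * Real.log n) := by
    rw [hU]
    have h1 : ((s : ℝ) + 1) * Real.log n ≤ (s + 1) * Real.log m * Real.log n := by
      rw [mul_assoc]
      exact mul_le_mul_of_nonneg_left (le_mul_of_one_le_left hlogn.le hlogm) hs0.le
    have h2 := mul_le_mul_of_nonneg_left h1 (by positivity : 0 ≤ 8 * (k : ℝ))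
    linarith
  have hrate' : n * remainderRate n s = (s + 1) * Real.log m * Real.log n := by
    rw [remainderRate, ← hm]
    field_simp
  refine le_of_mul_le_mul_left ?_ hn0
  calc n * sqNorm (g - f₀) ≤ n * sqNorm (f - f₀) +
        4 * (A * S * √(Real.log n)) * offNorm k (activeSet s t) f +
        (2 * U ^ 2 + 2 * W ^ 2) := by linarith
    _ ≤ n * sqNorm (f - f₀) + 4 * (A * S * √(Real.log n)) * offNorm k (activeSet s t) f +
        (8 * k + 4 * A ^ 2 * (6 * K) ^ (2 * k - 1) * C) *
          ((s + 1) * Real.log m * Real.log n) := by linarith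
    _ = _ := by
      rw [← hrate', ← hμ]
      ring

end TrendFiltering

/-! ### Assembly of the oracle inequality. -/

theorem corollary1p1 (k : ℕ) (hk : k ∈ ({1, 2, 3, 4} : Set ℕ))
    (s : ℕ → ℕ) (t : ℕ → ℕ → ℕ)
    (hknots : ∀ n, k < n → TrendFiltering.IsKnots k n (s n) (t n))
    (hlen : ∀ᶠ n in atTop, k * (k + 2) ≤ TrendFiltering.minLen (s n) (t n))
    (hbal : (fun n => (TrendFiltering.minLen (s n) (t n) : ℝ)) =Θ[atTop]
      fun n => (TrendFiltering.maxLen (s n) (t n) : ℝ)) :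
    ∃ lam : ℕ → ℝ, (∀ n, 0 < lam n) ∧
      lam =Θ[atTop] (fun n => TrendFiltering.tuningRate k n (s n)) ∧
      ∀ (Ω : ℕ → Type*) [∀ n, MeasurableSpace (Ω n)] (P : ∀ n, Measure (Ω n))
        [∀ n, IsProbabilityMeasure (P n)]
        (f₀ : ∀ n, TrendFiltering.Vec n)
        (Y fhat : ∀ n, Ω n → TrendFiltering.Vec n),
        (∀ n, HasLaw (Y n) (TrendFiltering.gaussianLaw (f₀ n)) (P n)) →
        (∀ n ω, TrendFiltering.IsEstimate k (lam n) (Y n ω) (fhat n ω)) →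
        ∀ f : ∀ n, TrendFiltering.Vec n,
          ∃ R : ∀ n, Ω n → ℝ,
            TrendFiltering.IsBoundedInProb P
              (fun n ω => R n ω / TrendFiltering.remainderRate n (s n)) ∧
            ∀ n ω, TrendFiltering.sqNorm (fhat n ω - f₀ n) ≤
              TrendFiltering.sqNorm (f n - f₀ n) +
                4 * lam n * TrendFiltering.offNorm k
                  (TrendFiltering.activeSet (s n) (t n)) (f n) +
                R n ω := by
  have hk1 : 1 ≤ k := by
    simp only [Set.mem_insert_iff, Set.mem_singleton_iff] at hk
    omega
  obtain ⟨c, C, hc, hC, hbump⟩ := TrendFiltering.exists_interpolating_bump hk1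
  obtain ⟨K, hK, hbalK⟩ := hbal.2.exists_pos
  set A : ℝ := 2 / c + 2 * √(K ^ (2 * k - 1)) with hA
  have hA0 : 0 < A := by positivity
  refine ⟨TrendFiltering.tuning A k s, TrendFiltering.tuning_pos hA0 k s,
    TrendFiltering.tuning_isTheta hA0 k s, ?_⟩
  intro Ω _ P _ f₀ Y fhat hY hfhat f
  set B : ∀ n, Ω n → ℝ := fun n ω => TrendFiltering.sqNorm (fhat n ω - f₀ n) -
    (TrendFiltering.sqNorm (f n - f₀ n) + 4 * TrendFiltering.tuning A k s n *
      TrendFiltering.offNorm k (TrendFiltering.activeSet (s n) (t n)) (f n)) with hB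
  -- The remainder is the positive part of the excess risk, so the inequality is automatic and only
  -- its order in probability needs proof.
  refine ⟨fun n ω => max (B n ω) 0, ?_, fun n ω => ?_⟩
  swap
  · have : B n ω ≤ max (B n ω) 0 := le_max_left _ _
    simp only [hB] at this ⊢
    linarith
  set M₀ : ℝ := 8 * k + 4 * A ^ 2 * (6 * K) ^ (2 * k - 1) * C with hM₀
  have hprob : ∀ M, M₀ ≤ M → ∀ᶠ n in atTop,
      P n {ω | M < |max (B n ω) 0 / TrendFiltering.remainderRate n (s n)|} ≤
        ENNReal.ofReal (4 / (n : ℝ)) := by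
    intro M hM
    filter_upwards [hlen, hbalK.bound, eventually_ge_atTop (2 * k + 2)] with n hn1 hn2 hn3
    obtain ⟨N, hN, a, β, hcard, hβ, haβ, hrate, hmain⟩ :=
      (hknots n (by omega)).oracle_event hk1 hc hC hK hbump hA hn1 (by simpa using hn2) hn3
    have hlam : TrendFiltering.tuning A k s n = A * TrendFiltering.tuningRate k n (s n) :=
      if_pos (by omega)
    refine le_trans ?_ (TrendFiltering.gaussianLaw_exists_abs_sum_gt_le (by omega) (f₀ n) a β hβ
      haβ hcard)
    -- Only the event in the data space need be measurable: the event for `fhat` is contained in its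
    -- preimage under `Y n`, so monotonicity of the measure suffices.
    have hmeas : MeasurableSet {y : TrendFiltering.Vec n |
        ∃ j, 2 * √(Real.log n) * β j < |∑ i, a j i * (y i - f₀ n i)|} := by
      refine IsOpen.measurableSet ?_
      rw [Set.ofPred_exists]
      exact isOpen_iUnion fun j => isOpen_lt (by fun_prop) (by fun_prop)
    rw [← (hY n).measure_eq hmeas]
    refine measure_mono fun ω hω => ?_
    by_contra hne
    simp only [Set.mem_ofPred_eq, not_exists, not_lt] at hne
    have h1 := hmain (f₀ n) (Y n ω) (fhat n ω) (f n) hne (by rw [← hlam]; exact hfhat n ω)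
    rw [← hlam] at h1
    have h2 : B n ω ≤ M * TrendFiltering.remainderRate n (s n) := by
      have := mul_le_mul_of_nonneg_right hM hrate.le
      simp only [hB]
      linarith
    have hM0 : 0 ≤ M := le_trans (by positivity) hM
    have hω' : M < |max (B n ω) 0 / TrendFiltering.remainderRate n (s n)| := hω
    refine absurd hω' (not_lt.2 ?_)
    rw [abs_of_nonneg (div_nonneg (le_max_right _ _) hrate.le), div_le_iff₀ hrate]
    exact max_le h2 (mul_nonneg hM0 hrate.le)
  have hzero : Tendsto (fun n : ℕ => ENNReal.ofReal (4 / (n : ℝ))) atTop (𝓝 0) := by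
    rw [← ENNReal.ofReal_zero]
    exact ENNReal.tendsto_ofReal (tendsto_const_div_atTop_nhds_zero_nat 4)
  -- For every `M ≥ M₀` the limsup is already zero, so the function of `M` is eventually constant.
  refine tendsto_const_nhds.congr' ?_
  filter_upwards [eventually_ge_atTop M₀] with M hM
  exact (tendsto_of_tendsto_of_tendsto_of_le_of_le' tendsto_const_nhds hzero
    (Eventually.of_forall fun _ => zero_le) (hprob M hM)).limsup_eq.symm
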